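/- Let $(\overline M,\overline g)$ be a smooth semi-Riemannian manifold (of constant index) with Levi-Civita connection $\overline\nabla$, of constant sectional curvature $c$, and let $M$ be a smooth (immersed) hypersurface of $\overline M$ that is lightlike: the induced metric $g$ has a radical $\mathrm{Rad}\,T_pM=\{v\in T_pM: g(v,w)=0\ \forall w\in T_pM\}$ of dimension one at every $p\in M$. Let $u\in M$. A *screen distribution* $S(TM)$ is a smooth distribution on $M$ with $TM=\mathrm{Rad}\,TM\oplus S(TM)$. At each point, for $0\neq\xi\in\mathrm{Rad}\,T_pM$, it determines a unique null vector $N\in T_p\overline M$ with $\overline g(N,\xi)=1$ and $N\perp S(T_pM)$. These vectors $N$ span the transversal line bundle $\mathrm{ltr}(TM)$, and $T\overline M|_M=TM\oplus\mathrm{ltr}(TM)$. The induced connection $\nabla_XY$ is the $TM$-component of $\overline\nabla_XY$, $R(X,Y)Z=\nabla_X\nabla_YZ-\nabla_Y\nabla_XZ-\nabla_{[X,Y]}Z$ is its curvature, $R(x,y,z,w)=g(R(x,y)z,w)$, and $\mathrm{Ric}(x,y)=\mathrm{trace}(z\mapsto R(x,z)y)$. The screen distribution is *admissible* if at every point of $M$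 $$R(x,y,z,w)=-R(y,x,z,w)=R(z,w,x,y),\qquad R(x,y,z,w)+R(y,z,x,w)+R(z,x,y,w)=0 .$$ For an admissible screen distribution let $\tilde g=g+\eta\otimes\eta$ with $\eta=\overline g(N,\cdot)$. This is nondegenerate on $T_uM$. The pseudo-Jacobi operator $J_R(x):T_uM\to T_uM$ is defined by $\tilde g(J_R(x)y,w)=R(y,x,x,w)$; it does not depend on the choice of $\xi$. Put $S_u^{\pm}(M)=\{x\in T_uM: g(x,x)=\pm1\}$. $M$ is *spacelike* (resp. *timelike*) *Osserman at $u$* if for every admissible screen distribution the characteristic polynomial of $J_R(x)$ is the same for all $x\in S_u^+(M)$ (resp. $x\in S_u^-(M)$). $M$ is *Osserman at $u$* if it is spacelike Osserman at $u$ and $S_u^+(M)\neq\emptyset$, or timelike Osserman at $u$ and $S_u^-(M)\neq\emptyset$, or if $S_u^+(M)=S_u^-(M)=\emptyset$ (i.e. $\dim M=1$). **Statement.** If $M$ is Osserman at $u$, then for every admissible screen distribution $S(TM)$ the hypersurface $(M,g,S(TM))$ is Einstein at $u$: there is $\lambda\in\mathbb R$ with $\mathrm{Ric}(x,y)=\lambda\,g(x,y)$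 for all $x,y\in T_uM$. -/

import Mathlib

open scoped Manifold ContDiff Topology
open Module

noncomputable section

namespace LightlikeGeometry

/-! ### Bilinear forms and algebraic curvature tensors -/

section Algebra

variable {V W : Type*} [AddCommGroup V] [Module ℝ V] [TopologicalSpace V]
  [AddCommGroup W] [Module ℝ W] [TopologicalSpace W]

/-- The pullback `(w, w') ↦ b (A w) (A w')` of a bilinear form `b` along a linear map `A`. -/
def pullbackForm (b : V →L[ℝ] V →L[ℝ] ℝ) (A : W →L[ℝ] V) : W →L[ℝ] W →L[ℝ] ℝ :=
  (ContinuousLinearMap.precomp ℝ A) ∘L b ∘L A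

@[simp]
theorem pullbackForm_apply (b : V →L[ℝ] V →L[ℝ] ℝ) (A : W →L[ℝ] V) (w w' : W) :
    pullbackForm b A w w' = b (A w) (A w') := rfl

/-- `ν` is the index of the form `b`: the largest dimension of a subspace on which `b` is negative
definite. -/
def HasIndex (b : V →L[ℝ] V →L[ℝ] ℝ) (ν : ℕ) : Prop :=
  IsGreatest {k : ℕ | ∃ U : Submodule ℝ V, finrank ℝ U = k ∧ ∀ w ∈ U, w ≠ 0 → b w w < 0} ν

/-- The radical `{v | b v w = 0 for all w}` of a bilinear form. -/
def radical (b : V →L[ℝ] V →L[ℝ] ℝ) : Submodule ℝ V := LinearMap.ker (b : V →ₗ[ℝ] V →L[ℝ] ℝ)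

/-- An algebraic curvature tensor on a vector space. -/
structure IsAlgebraicCurvature (T : V → V → V → V → ℝ) : Prop where
  skew : ∀ x y z w, T x y z w = -T y x z w
  pair_symm : ∀ x y z w, T x y z w = T z w x y
  bianchi : ∀ x y z w, T x y z w + T y z x w + T z x y w = 0

end Algebra

/-! ### Christoffel symbols and curvature in coordinates -/

section Coordinates

variable {F : Type*} [NormedAddCommGroup F] [NormedSpace ℝ F]

set_option maxSynthPendingDepth 4 in
/-- The `(0,3)`-tensor `½ (∂_v G(w, z) + ∂_w G(v, z) - ∂_z G(v, w))` of Christoffel symbols of the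
first kind of a metric `G` given in coordinates. -/
def christoffelLower (G : F → F →L[ℝ] F →L[ℝ] ℝ) (y : F) : F →L[ℝ] F →L[ℝ] F →L[ℝ] ℝ :=
  let D : F →L[ℝ] F →L[ℝ] F →L[ℝ] ℝ := fderiv ℝ G y
  let T : (F →L[ℝ] F →L[ℝ] ℝ) →L[ℝ] F →L[ℝ] F →L[ℝ] ℝ :=
    (ContinuousLinearMap.flipₗᵢ ℝ F F ℝ).toContinuousLinearEquiv
  let D' : F →L[ℝ] F →L[ℝ] F →L[ℝ] ℝ := T ∘L D.flip
  (1 / 2 : ℝ) • (D + D.flip - D')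

set_option maxSynthPendingDepth 4 in
theorem christoffelLower_apply (G : F → F →L[ℝ] F →L[ℝ] ℝ) (y v w z : F) :
    christoffelLower G y v w z =
      (1 / 2) * (fderiv ℝ G y v w z + fderiv ℝ G y w v z - fderiv ℝ G y z v w) := rfl

/-- The Christoffel symbols `Γ(v, w)` of the Levi-Civita connection of a metric `G` given in
coordinates, `G(Γ(v, w), z) = ½ (∂_v G(w, z) + ∂_w G(v, z) - ∂_z G(v, w))`; the Levi-Civita
connection is `∇_v W = ∂_v W + Γ(v, W)`. -/
def christoffel (G : F → F →L[ℝ] F →L[ℝ] ℝ) (y : F) : F →L[ℝ] F →L[ℝ] F :=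
  (ContinuousLinearMap.compL ℝ F (F →L[ℝ] ℝ) F (G y).inverse) ∘L christoffelLower G y

theorem christoffel_apply (G : F → F →L[ℝ] F →L[ℝ] ℝ) (y v w : F) :
    christoffel G y v w = (G y).inverse (christoffelLower G y v w) := rfl

/-- The curvature `R(v, w)z = ∇_v ∇_w z - ∇_w ∇_v z - ∇_[v, w] z` at `x` of the linear connection
`∇_v Z = ∂_v Z + Γ(v, Z)` given in coordinates. -/
def curvature (Γ : F → F →L[ℝ] F →L[ℝ] F) (x : F) : F →L[ℝ] F →L[ℝ] F →L[ℝ] F :=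
  let D : F →L[ℝ] F →L[ℝ] F →L[ℝ] F := fderiv ℝ Γ x
  let Q : F →L[ℝ] F →L[ℝ] F →L[ℝ] F := (ContinuousLinearMap.compL ℝ F F F).bilinearComp (Γ x) (Γ x)
  D - D.flip + (Q - Q.flip)

theorem curvature_apply (Γ : F → F →L[ℝ] F →L[ℝ] F) (x v w z : F) :
    curvature Γ x v w z = fderiv ℝ Γ x v w z - fderiv ℝ Γ x w v z
      + (Γ x v (Γ x w z) - Γ x w (Γ x v z)) := rfl

end Coordinates

/-! ### Semi-Riemannian manifolds -/

section Ambient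

variable {F : Type*} [NormedAddCommGroup F] [NormedSpace ℝ F]
  {N : Type*} [TopologicalSpace N] [ChartedSpace F N]

/-- The expression of a field `g` of bilinear forms in the preferred chart at `q`. -/
def metricInChart
    (g : ∀ q : N, TangentSpace 𝓘(ℝ, F) q →L[ℝ] TangentSpace 𝓘(ℝ, F) q →L[ℝ] ℝ) (q : N) (y : F) :
    F →L[ℝ] F →L[ℝ] ℝ :=
  pullbackForm (g ((chartAt F q).symm y)) (mfderiv 𝓘(ℝ, F) 𝓘(ℝ, F) (chartAt F q).symm y)

variable (F N) in
/-- A semi-Riemannian metric: a smooth field of symmetric nondegenerate bilinear forms of constant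
index on the tangent spaces. -/
structure SemiRiemannianMetric where
  form : ∀ q : N, TangentSpace 𝓘(ℝ, F) q →L[ℝ] TangentSpace 𝓘(ℝ, F) q →L[ℝ] ℝ
  symm : ∀ q v w, form q v w = form q w v
  nondegenerate : ∀ q v, (∀ w, form q v w = 0) → v = 0
  constant_index : ∃ ν : ℕ, ∀ q, HasIndex (form q) ν
  smooth : ∀ q, ContDiffOn ℝ ∞ (metricInChart form q) (chartAt F q).target

namespace SemiRiemannianMetric

variable (g : SemiRiemannianMetric F N)

/-- The Riemann curvature `R(x, y)z` of the Levi-Civita connection, as a tensor on the tangent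
space at `q`. It is computed in the preferred chart at `q`, which identifies the tangent space at
`q` with the model space `F`. -/
def riemann (q : N) :
    TangentSpace 𝓘(ℝ, F) q →L[ℝ] TangentSpace 𝓘(ℝ, F) q →L[ℝ] TangentSpace 𝓘(ℝ, F) q →L[ℝ]
      TangentSpace 𝓘(ℝ, F) q :=
  (curvature (christoffel (metricInChart g.form q)) (chartAt F q q) : F →L[ℝ] F →L[ℝ] F →L[ℝ] F)

/-- The sectional curvature of the plane spanned by `v` and `w` (meaningful if the plane is
nondegenerate, i.e. if the denominator does not vanish). -/
def sectionalCurvature (q : N) (v w : TangentSpace 𝓘(ℝ, F) q) : ℝ :=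
  g.form q (g.riemann q v w w) v / (g.form q v v * g.form q w w - g.form q v w ^ 2)

/-- All nondegenerate tangent planes have sectional curvature `c`. -/
def HasConstantSectionalCurvature (c : ℝ) : Prop :=
  ∀ (q : N) (v w : TangentSpace 𝓘(ℝ, F) q),
    g.form q v v * g.form q w w - g.form q v w ^ 2 ≠ 0 → g.sectionalCurvature q v w = c

end SemiRiemannianMetric

end Ambient

/-! ### Lightlike hypersurfaces -/

section Hypersurface

variable {E : Type*} [NormedAddCommGroup E] [NormedSpace ℝ E]
  {F : Type*} [NormedAddCommGroup F] [NormedSpace ℝ F]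
  {M : Type*} [TopologicalSpace M] [ChartedSpace E M] [IsManifold 𝓘(ℝ, E) ∞ M]
  {N : Type*} [TopologicalSpace N] [ChartedSpace F N]
  (g : SemiRiemannianMetric F N) (f : M → N)

/-- The metric on `M` induced by `f : M → N`. -/
def inducedMetric (p : M) : TangentSpace 𝓘(ℝ, E) p →L[ℝ] TangentSpace 𝓘(ℝ, E) p →L[ℝ] ℝ :=
  pullbackForm (g.form (f p)) (mfderiv 𝓘(ℝ, E) 𝓘(ℝ, F) f p)

/-- `f` is an immersion of `M` as a hypersurface of `N` whose induced metric is degenerate with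
radical of rank one at every point, i.e. `M` is a lightlike hypersurface of `N`. -/
structure IsLightlikeHypersurface : Prop where
  codimension_one : finrank ℝ F = finrank ℝ E + 1
  smooth : ContMDiff 𝓘(ℝ, E) 𝓘(ℝ, F) ∞ f
  immersive : ∀ p : M, Function.Injective (mfderiv 𝓘(ℝ, E) 𝓘(ℝ, F) f p)
  finrank_radical : ∀ p : M, finrank ℝ (radical (inducedMetric (E := E) g f p)) = 1

/-- A screen distribution: a smooth distribution complementary to the radical distribution.
(It is automatically orthogonal to the radical, and the induced metric is nondegenerate on it.) -/
structure ScreenDistribution where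
  space : ∀ p : M, Submodule ℝ (TangentSpace 𝓘(ℝ, E) p)
  isCompl : ∀ p, IsCompl (radical (inducedMetric (E := E) g f p)) (space p)
  smooth : ∀ p : M, ∃ U : Set M, IsOpen U ∧ p ∈ U ∧
    ∃ (k : ℕ) (X : Fin k → ∀ q : M, TangentSpace 𝓘(ℝ, E) q),
      (∀ i, ContMDiffOn 𝓘(ℝ, E) 𝓘(ℝ, E).tangent ∞
        (fun q => (⟨q, X i q⟩ : TangentBundle 𝓘(ℝ, E) M)) U) ∧
      ∀ q ∈ U, LinearIndependent ℝ (fun i => X i q) ∧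
        space q = Submodule.span ℝ (Set.range fun i => X i q)

namespace ScreenDistribution

variable {g f} (S : ScreenDistribution (E := E) g f)

/-- `(ξ, n)` is a normalizing pair at `p`: `ξ` spans the radical and `n` is the null vector of the
ambient tangent space orthogonal to the screen with `g(n, ξ) = 1`. -/
structure IsNormalizingPair (p : M) (ξ : TangentSpace 𝓘(ℝ, E) p)
    (n : TangentSpace 𝓘(ℝ, F) (f p)) : Prop where
  mem_radical : ξ ∈ radical (inducedMetric (E := E) g f p)
  null : g.form (f p) n n = 0
  orthogonal : ∀ s ∈ S.space p, g.form (f p) n (mfderiv 𝓘(ℝ, E) 𝓘(ℝ, F) f p s) = 0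
  normalized : g.form (f p) n (mfderiv 𝓘(ℝ, E) 𝓘(ℝ, F) f p ξ) = 1

/-- The fibre at `p` of the lightlike transversal line bundle `ltr(TM)` of the screen. -/
def ltr (p : M) : Submodule ℝ (TangentSpace 𝓘(ℝ, F) (f p)) :=
  Submodule.span ℝ {n | ∃ ξ, S.IsNormalizingPair p ξ n}

/-- The projection of the ambient tangent space onto the tangent space of `M` along `ltr(TM)`:
the unique linear map that is a left inverse of the differential of `f` and vanishes on `ltr(TM)`.
-/
def tangentialProjection (p : M) :
    TangentSpace 𝓘(ℝ, F) (f p) →L[ℝ] TangentSpace 𝓘(ℝ, E) p :=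
  Classical.epsilon fun τ =>
    (∀ v, τ (mfderiv 𝓘(ℝ, E) 𝓘(ℝ, F) f p v) = v) ∧ ∀ n ∈ S.ltr p, τ n = 0

/-- The map `f` in the preferred charts at `p` and `f p`. -/
def mapInChart (f : M → N) (p : M) (x : E) : F := chartAt F (f p) (f ((chartAt E p).symm x))

/-- The tangential projection in the preferred charts at `p` and `f p`. -/
def tangentialProjectionInChart (p : M) (x : E) : F →L[ℝ] E :=
  let q : M := (chartAt E p).symm x
  (mfderiv 𝓘(ℝ, E) 𝓘(ℝ, E) (chartAt E p) q : TangentSpace 𝓘(ℝ, E) q →L[ℝ] E) ∘L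
    S.tangentialProjection q ∘L
    (mfderiv 𝓘(ℝ, F) 𝓘(ℝ, F) (chartAt F (f p)) (f q) :
      TangentSpace 𝓘(ℝ, F) (f q) →L[ℝ] F).inverse

/-- The connection coefficients, in the preferred charts at `p` and `f p`, of the connection `∇`
induced on `M` by the screen: for coordinate vector fields `v`, `w` on `M`, `∇_v w` is the
tangential part of the ambient Levi-Civita derivative
`∂_v ∂_w f + Γ(∂_v f, ∂_w f)` of `df(w)` along `f`. -/
def inducedChristoffel (p : M) (x : E) : E →L[ℝ] E →L[ℝ] E :=
  (ContinuousLinearMap.compL ℝ E F E (S.tangentialProjectionInChart p x)) ∘L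
    (fderiv ℝ (fderiv ℝ (mapInChart f p)) x +
      (christoffel (metricInChart g.form (f p)) (mapInChart f p x)).bilinearComp
        (fderiv ℝ (mapInChart f p) x) (fderiv ℝ (mapInChart f p) x))

/-- The curvature `R(x, y)z` of the induced connection, as a tensor on the tangent space at `p`. -/
def inducedCurvature (p : M) :
    TangentSpace 𝓘(ℝ, E) p →L[ℝ] TangentSpace 𝓘(ℝ, E) p →L[ℝ] TangentSpace 𝓘(ℝ, E) p →L[ℝ]
      TangentSpace 𝓘(ℝ, E) p :=
  (curvature (S.inducedChristoffel p) (chartAt E p p) : E →L[ℝ] E →L[ℝ] E →L[ℝ] E)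

/-- The induced `(0,4)`-curvature `R(x, y, z, w) = g(R(x, y)z, w)`. -/
def inducedCurvature₄ (p : M) (x y z w : TangentSpace 𝓘(ℝ, E) p) : ℝ :=
  inducedMetric (E := E) g f p (S.inducedCurvature p x y z) w

/-- The screen is admissible if its induced curvature is an algebraic curvature tensor at every
point. -/
def IsAdmissible : Prop := ∀ p : M, IsAlgebraicCurvature (S.inducedCurvature₄ p)

/-- The induced Ricci tensor `Ric(x, y) = trace (z ↦ R(x, z)y)`. -/
def ricci (p : M) (x y : TangentSpace 𝓘(ℝ, E) p) : ℝ :=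
  let R : E →L[ℝ] E →L[ℝ] E →L[ℝ] E := S.inducedCurvature p
  LinearMap.trace ℝ E ((R x).flip y : E →L[ℝ] E)

/-- `(M, g, S(TM))` is Einstein at `p`. -/
def IsEinsteinAt (p : M) : Prop :=
  ∃ l : ℝ, ∀ x y, S.ricci p x y = l * inducedMetric (E := E) g f p x y

/-- The nondegenerate metric `g̃ = g + η ⊗ η` at `p`, where `η = g(n, ·)` for the null transversal
vector `n` of a normalizing pair. -/
def associatedMetric (p : M) (n : TangentSpace 𝓘(ℝ, F) (f p)) :
    TangentSpace 𝓘(ℝ, E) p →L[ℝ] TangentSpace 𝓘(ℝ, E) p →L[ℝ] ℝ :=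
  let η : TangentSpace 𝓘(ℝ, E) p →L[ℝ] ℝ := g.form (f p) n ∘L mfderiv 𝓘(ℝ, E) 𝓘(ℝ, F) f p
  inducedMetric (E := E) g f p + η.smulRight η

/-- The pseudo-Jacobi operator `J(x)` at `p`, given by `g̃(J(x)y, w) = R(y, x, x, w)`. -/
def pseudoJacobi (p : M) (n : TangentSpace 𝓘(ℝ, F) (f p)) (x : TangentSpace 𝓘(ℝ, E) p) :
    E →ₗ[ℝ] E :=
  let R : E →L[ℝ] E →L[ℝ] E →L[ℝ] E := S.inducedCurvature p
  let b : E →L[ℝ] E →L[ℝ] ℝ := inducedMetric (E := E) g f p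
  let b' : E →L[ℝ] E →L[ℝ] ℝ := associatedMetric (g := g) p n
  (b'.inverse ∘L b ∘L ((R.flip x).flip x) : E →L[ℝ] E)

end ScreenDistribution

/-- The pseudo-sphere `{x | g(x, x) = ε}` in the tangent space of `M` at `p`. -/
def pseudoSphere (p : M) (ε : ℝ) : Set (TangentSpace 𝓘(ℝ, E) p) :=
  {x | inducedMetric (E := E) g f p x x = ε}

/-- For every admissible screen, the characteristic polynomial of `J(x)` does not depend on
`x` in the pseudo-sphere of radius `ε`: spacelike Osserman at `p` for `ε = 1`, timelike Osserman at
`p` for `ε = -1`. (`J(x)` does not depend on the normalizing pair.) -/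
def IsOssermanOn [FiniteDimensional ℝ E] (p : M) (ε : ℝ) : Prop :=
  ∀ S : ScreenDistribution (E := E) g f, S.IsAdmissible → ∀ ξ n, S.IsNormalizingPair p ξ n →
    ∀ x ∈ pseudoSphere (E := E) g f p ε, ∀ y ∈ pseudoSphere (E := E) g f p ε,
      (S.pseudoJacobi p n x).charpoly = (S.pseudoJacobi p n y).charpoly

/-- Osserman at `p`: spacelike or timelike Osserman at `p`, where a causal type counts only if
unit vectors of this type exist; no condition if there are no unit vectors at all. -/
def IsOssermanAt [FiniteDimensional ℝ E] (p : M) : Prop :=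
  ((pseudoSphere (E := E) g f p 1).Nonempty ∧ IsOssermanOn (E := E) g f p 1) ∨
  ((pseudoSphere (E := E) g f p (-1)).Nonempty ∧ IsOssermanOn (E := E) g f p (-1)) ∨
  (pseudoSphere (E := E) g f p 1 = ∅ ∧ pseudoSphere (E := E) g f p (-1) = ∅)

end Hypersurface

end LightlikeGeometry

end

/-!
Let `ξ` span the radical at `u`, let `n` be the null transversal vector and `η = g(n, ·)`. The
endomorphism `P` with `g̃(P v, w) = g(v, w)` is the projection `v ↦ v - η(v) ξ` onto the screen, so

`Ric(x, y) = trace (z ↦ P R(x, z)y) + η(R(x, ξ)y)`.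

The first term is a bilinear form in `x` and `y`, symmetric because `z ↦ P R(x, z)y` and
`z ↦ P R(y, z)x` are `g̃`-adjoint to each other by the pair symmetry of `R`; for `y = x` it is minus
the trace of the pseudo-Jacobi operator of `x`. The Osserman condition makes it constant on a
pseudo-sphere, hence a multiple of `g`.

For the second term, `n` is null, so that `∇̄_v n` has no `ξ`-component, and the Gauss equation
gives `g(n, R(x, ξ)y) = g(n, R̄(x, ξ)y)`. Constant sectional curvature `c` evaluates this to
`-c g(x, y)`.

If there are no unit vectors, then `g = 0` at `u`, hence `dim M = 1` and `R = 0`.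
-/

noncomputable section

namespace LightlikeGeometry

/-! ### Linear connections and their curvature -/

section Calculus

variable {E F H K : Type*} [NormedAddCommGroup E] [NormedSpace ℝ E] [NormedAddCommGroup F]
  [NormedSpace ℝ F] [NormedAddCommGroup H] [NormedSpace ℝ H] [NormedAddCommGroup K]
  [NormedSpace ℝ K] {x : E}

theorem fderiv_clm_apply_apply {A : E → F →L[ℝ] H} {s : E → F} (hA : DifferentiableAt ℝ A x)
    (hs : DifferentiableAt ℝ s x) (v : E) :
    fderiv ℝ (fun y => A y (s y)) x v = fderiv ℝ A x v (s x) + A x (fderiv ℝ s x v) := by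
  rw [fderiv_clm_apply hA hs]
  exact add_comm _ _

theorem fderiv_clm_apply_const {A : E → F →L[ℝ] H} (hA : DifferentiableAt ℝ A x) (s : F) (v : E) :
    fderiv ℝ (fun y => A y s) x v = fderiv ℝ A x v s := by
  simp [fderiv_clm_apply_apply hA (differentiableAt_const s)]

theorem fderiv_bilin_apply {B : E → F →L[ℝ] H →L[ℝ] K} {s : E → F} {t : E → H}
    (hB : DifferentiableAt ℝ B x) (hs : DifferentiableAt ℝ s x) (ht : DifferentiableAt ℝ t x)
    (v : E) :
    fderiv ℝ (fun y => B y (s y) (t y)) x v =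
      fderiv ℝ B x v (s x) (t x) + B x (fderiv ℝ s x v) (t x) + B x (s x) (fderiv ℝ t x v) := by
  rw [fderiv_clm_apply_apply (hB.clm_apply hs) ht, fderiv_clm_apply_apply hB hs, add_apply]

theorem fderiv_bilin_symm {B : E → F →L[ℝ] F →L[ℝ] H} (hB : DifferentiableAt ℝ B x)
    (hs : ∀ᶠ y in 𝓝 x, ∀ v w, B y v w = B y w v) (u : E) (v w : F) :
    fderiv ℝ B x u v w = fderiv ℝ B x u w v := by
  have fderiv_apply : ∀ v w, fderiv ℝ (fun y => B y v w) x u = fderiv ℝ B x u v w := fun v w => by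
    simp [fderiv_bilin_apply hB (differentiableAt_const v) (differentiableAt_const w)]
  have hsymm : (fun y => B y v w) =ᶠ[𝓝 x] fun y => B y w v := hs.mono fun y hy => hy v w
  rw [← fderiv_apply, hsymm.fderiv_eq, fderiv_apply]

theorem fderiv_fderiv_comm {φ : E → F} (hφ : ContDiffAt ℝ 2 φ x) (v w : E) :
    fderiv ℝ (fderiv ℝ φ) x v w = fderiv ℝ (fderiv ℝ φ) x w v :=
  hφ.isSymmSndFDerivAt (minSmoothness_of_isRCLikeNormedField (𝕜 := ℝ)).le v w

theorem differentiableAt_fderiv {φ : E → F} (hφ : ContDiffAt ℝ 2 φ x) :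
    DifferentiableAt ℝ (fderiv ℝ φ) x :=
  (hφ.fderiv_right (m := 1) (by norm_num [one_add_one_eq_two])).differentiableAt one_ne_zero

theorem eventually_differentiableAt {φ : E → F} (hφ : ContDiffAt ℝ 1 φ x) :
    ∀ᶠ y in 𝓝 x, DifferentiableAt ℝ φ y :=
  (hφ.eventually (by simp)).mono fun _ hy => hy.differentiableAt one_ne_zero

end Calculus

section Connections

variable {E F : Type*} [NormedAddCommGroup E] [NormedSpace ℝ E] [NormedAddCommGroup F]
  [NormedSpace ℝ F] {A : E → E →L[ℝ] F →L[ℝ] F} {B : E → F →L[ℝ] F →L[ℝ] ℝ} {s t : E → F} {x : E}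

/-- The covariant derivative `∇_v s = ∂_v s + A(v) s` of a section `s` of the trivial bundle with
fibre `F` over `E`, for the linear connection with connection form `A`. -/
def covDeriv (A : E → E →L[ℝ] F →L[ℝ] F) (s : E → F) (x v : E) : F :=
  fderiv ℝ s x v + A x v (s x)

/-- The curvature `R(v, w)z = ∇_v ∇_w z - ∇_w ∇_v z`, for commuting `v` and `w`, of the linear
connection with connection form `A`. -/
def bundleCurvature (A : E → E →L[ℝ] F →L[ℝ] F) (x v w : E) (z : F) : F :=
  fderiv ℝ A x v w z - fderiv ℝ A x w v z + (A x v (A x w z) - A x w (A x v z))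

/-- The connection `A` is compatible at `x` with the field `B` of bilinear forms:
`(∇_v B)(z, z') = 0`. -/
def IsCompatibleAt (A : E → E →L[ℝ] F →L[ℝ] F) (B : E → F →L[ℝ] F →L[ℝ] ℝ) (x : E) : Prop :=
  ∀ v z z', fderiv ℝ B x v z z' = B x (A x v z) z' + B x z (A x v z')

theorem bundleCurvature_skew (A : E → E →L[ℝ] F →L[ℝ] F) (x v w : E) (z : F) :
    bundleCurvature A x v w z = -bundleCurvature A x w v z := by
  simp only [bundleCurvature]
  abel

theorem differentiableAt_covDeriv (hA : DifferentiableAt ℝ A x) (hs : ContDiffAt ℝ 2 s x) (v : E) :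
    DifferentiableAt ℝ (fun y => covDeriv A s y v) x :=
  ((differentiableAt_fderiv hs).clm_apply (differentiableAt_const v)).add
    ((hA.clm_apply (differentiableAt_const v)).clm_apply (hs.differentiableAt two_ne_zero))

theorem covDeriv_covDeriv_sub (hA : DifferentiableAt ℝ A x) (hs : ContDiffAt ℝ 2 s x) (v w : E) :
    covDeriv A (fun y => covDeriv A s y w) x v - covDeriv A (fun y => covDeriv A s y v) x w =
      bundleCurvature A x v w (s x) := by
  have hds := differentiableAt_fderiv hs
  have hs' : DifferentiableAt ℝ s x := hs.differentiableAt two_ne_zero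
  have covDeriv_covDeriv : ∀ v w, covDeriv A (fun y => covDeriv A s y w) x v =
      fderiv ℝ (fderiv ℝ s) x v w + (fderiv ℝ A x v w (s x) + A x w (fderiv ℝ s x v))
        + A x v (covDeriv A s x w) := by
    intro v w
    have hAw := hA.clm_apply (differentiableAt_const w)
    rw [covDeriv, show (fun y => covDeriv A s y w) =
        (fun y => fderiv ℝ s y w) + fun y => A y w (s y) from rfl,
      fderiv_add (hds.clm_apply (differentiableAt_const w)) (hAw.clm_apply hs'), add_apply,
      fderiv_clm_apply_const hds, fderiv_clm_apply_apply hAw hs', fderiv_clm_apply_const hA]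
  rw [covDeriv_covDeriv, covDeriv_covDeriv, fderiv_fderiv_comm hs v w]
  simp only [covDeriv, bundleCurvature, map_add]
  abel

theorem IsCompatibleAt.fderiv_apply (hAB : IsCompatibleAt A B x) (hB : DifferentiableAt ℝ B x)
    (hs : DifferentiableAt ℝ s x) (ht : DifferentiableAt ℝ t x) (v : E) :
    fderiv ℝ (fun y => B y (s y) (t y)) x v =
      B x (covDeriv A s x v) (t x) + B x (s x) (covDeriv A t x v) := by
  rw [fderiv_bilin_apply hB hs ht, hAB]
  simp only [covDeriv, map_add, add_apply]
  ring

/-- Apply `∂_v ∂_w - ∂_w ∂_v = 0` to the function `B(z, z')`. -/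
theorem bundleCurvature_skewAdjoint (hAB : ∀ᶠ y in 𝓝 x, IsCompatibleAt A B y)
    (hA : DifferentiableAt ℝ A x) (hB : ContDiffAt ℝ 2 B x) (v w : E) (z z' : F) :
    B x (bundleCurvature A x v w z) z' = -B x z (bundleCurvature A x v w z') := by
  have hBd : ∀ᶠ y in 𝓝 x, DifferentiableAt ℝ B y :=
    eventually_differentiableAt (hB.of_le one_le_two)
  have hB1 := hBd.self_of_nhds
  have hBz : ContDiffAt ℝ 2 (fun y => B y z z') x :=
    (hB.clm_apply contDiffAt_const).clm_apply contDiffAt_const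
  have hd : ∀ v z, DifferentiableAt ℝ (fun y => covDeriv A (fun _ => z) y v) x :=
    fun v z => differentiableAt_covDeriv hA contDiffAt_const v
  have fderiv_fderiv : ∀ v w, fderiv ℝ (fderiv ℝ fun y => B y z z') x v w =
      B x (covDeriv A (fun y => covDeriv A (fun _ => z) y w) x v) z'
        + B x (covDeriv A (fun _ => z) x w) (covDeriv A (fun _ => z') x v)
        + (B x (covDeriv A (fun _ => z) x v) (covDeriv A (fun _ => z') x w)
          + B x z (covDeriv A (fun y => covDeriv A (fun _ => z') y w) x v)) := by
    intro v w
    have first_derivative : (fun y => fderiv ℝ (fun y => B y z z') y w) =ᶠ[𝓝 x]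
        (fun y => B y (covDeriv A (fun _ => z) y w) z')
          + fun y => B y z (covDeriv A (fun _ => z') y w) := by
      filter_upwards [hAB, hBd] with y hy hBy
      exact hy.fderiv_apply hBy (differentiableAt_const z) (differentiableAt_const z') w
    rw [← fderiv_clm_apply_const (differentiableAt_fderiv hBz), first_derivative.fderiv_eq,
      fderiv_add ((hB1.clm_apply (hd w z)).clm_apply (differentiableAt_const z'))
        ((hB1.clm_apply (differentiableAt_const z)).clm_apply (hd w z')), add_apply,
      hAB.self_of_nhds.fderiv_apply hB1 (hd w z) (differentiableAt_const z'),
      hAB.self_of_nhds.fderiv_apply hB1 (differentiableAt_const z) (hd w z')]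
  have hcomm := fderiv_fderiv_comm hBz v w
  rw [fderiv_fderiv, fderiv_fderiv] at hcomm
  have curvature_const := fun z : F => covDeriv_covDeriv_sub hA (contDiffAt_const (c := z)) v w
  rw [← curvature_const z, ← curvature_const z', map_sub, map_sub, sub_apply]
  linarith

end Connections

/-! ### The Gauss equation -/

section Gauss

variable {E F : Type*} [NormedAddCommGroup E] [NormedSpace ℝ E] [NormedAddCommGroup F]
  [NormedSpace ℝ F] {A : E → E →L[ℝ] F →L[ℝ] F} {B : E → F →L[ℝ] F →L[ℝ] ℝ}
  {Γ : E → E →L[ℝ] E →L[ℝ] E} {Φ : E → E →L[ℝ] F} {n σ : E → F} {x : E}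

theorem covDeriv_add {s t : E → F} (hs : DifferentiableAt ℝ s x) (ht : DifferentiableAt ℝ t x)
    (v : E) : covDeriv A (s + t) x v = covDeriv A s x v + covDeriv A t x v := by
  simp only [covDeriv, fderiv_add hs ht, Pi.add_apply, add_apply, map_add]
  abel

/-- The connection `Γ` is obtained from the connection `A` at `x` by differentiating along the
bundle map `Φ` and dropping multiples of the transversal vector `n`: this is the Gauss formula
`∇_v (Φ Y) = Φ (∇_v Y) + β n`. -/
def IsInducedAt (A : E → E →L[ℝ] F →L[ℝ] F) (Φ : E → E →L[ℝ] F) (n : E → F)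
    (Γ : E → E →L[ℝ] E →L[ℝ] E) (x : E) : Prop :=
  ∀ v z, ∃ β : ℝ, covDeriv A (fun y => Φ y z) x v = Φ x (Γ x v z) + β • n x

theorem IsInducedAt.covDeriv_comp (h : IsInducedAt A Φ n Γ x) (hΦ : DifferentiableAt ℝ Φ x)
    {Y : E → E} (hY : DifferentiableAt ℝ Y x) (v : E) :
    ∃ β : ℝ, covDeriv A (fun y => Φ y (Y y)) x v = Φ x (covDeriv Γ Y x v) + β • n x := by
  obtain ⟨β, hβ⟩ := h v (Y x)
  refine ⟨β, ?_⟩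
  rw [covDeriv, fderiv_clm_apply_const hΦ] at hβ
  rw [covDeriv, fderiv_clm_apply_apply hΦ hY, add_right_comm, hβ, covDeriv, map_add]
  abel

theorem form_covDeriv_self_of_null (hAB : IsCompatibleAt A B x) (hB : DifferentiableAt ℝ B x)
    (hs : ∀ v w, B x v w = B x w v) (hn : DifferentiableAt ℝ n x)
    (hnull : ∀ᶠ y in 𝓝 x, B y (n y) (n y) = 0) (v : E) : B x (n x) (covDeriv A n x v) = 0 := by
  have hderiv := hAB.fderiv_apply hB hn hn v
  have hzero : (fun y => B y (n y) (n y)) =ᶠ[𝓝 x] fun _ => 0 := hnull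
  rw [hzero.fderiv_eq, fderiv_const_apply, zero_apply, hs _ (n x)] at hderiv
  linarith

theorem form_covDeriv_of_eventually_smul (hAB : IsCompatibleAt A B x)
    (hB : DifferentiableAt ℝ B x) (hs : ∀ v w, B x v w = B x w v) (hn : DifferentiableAt ℝ n x)
    (hnull : ∀ᶠ y in 𝓝 x, B y (n y) (n y) = 0) (hσ : DifferentiableAt ℝ σ x)
    (hσn : ∀ᶠ y in 𝓝 x, ∃ β : ℝ, σ y = β • n y) (v : E) :
    B x (n x) (covDeriv A σ x v) = 0 := by
  have hderiv := hAB.fderiv_apply hB hn hσ v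
  have hzero : (fun y => B y (n y) (σ y)) =ᶠ[𝓝 x] fun _ => 0 := by
    filter_upwards [hnull, hσn] with y hy ⟨β, hβ⟩
    rw [hβ, map_smul, hy, smul_zero]
  obtain ⟨β, hβ⟩ := hσn.self_of_nhds
  rw [hzero.fderiv_eq, fderiv_const_apply, zero_apply, hβ, map_smul, hs,
    form_covDeriv_self_of_null hAB hB hs hn hnull, smul_zero, zero_add] at hderiv
  exact hderiv.symm

theorem form_covDeriv_covDeriv_eq (hAB : IsCompatibleAt A B x) (hB : DifferentiableAt ℝ B x)
    (hs : ∀ v w, B x v w = B x w v) (hn : DifferentiableAt ℝ n x)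
    (hnull : ∀ᶠ y in 𝓝 x, B y (n y) (n y) = 0) (hA : DifferentiableAt ℝ A x)
    (hΓ : DifferentiableAt ℝ Γ x) (hΦ : ContDiffAt ℝ 2 Φ x)
    (h : ∀ᶠ y in 𝓝 x, IsInducedAt A Φ n Γ y) (v w z : E) :
    B x (n x) (covDeriv A (fun y => covDeriv A (fun y => Φ y z) y w) x v) =
      B x (n x) (Φ x (covDeriv Γ (fun y => covDeriv Γ (fun _ => z) y w) x v)) := by
  have hΦ' : DifferentiableAt ℝ Φ x := hΦ.differentiableAt two_ne_zero
  let Y : E → E := fun y => covDeriv Γ (fun _ => z) y w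
  have hY : DifferentiableAt ℝ Y x := differentiableAt_covDeriv hΓ contDiffAt_const w
  let σ : E → F := fun y => covDeriv A (fun y => Φ y z) y w - Φ y (Y y)
  have hσ : DifferentiableAt ℝ σ x :=
    (differentiableAt_covDeriv hA (hΦ.clm_apply contDiffAt_const) w).sub (hΦ'.clm_apply hY)
  have hσn : ∀ᶠ y in 𝓝 x, ∃ β : ℝ, σ y = β • n y := by
    filter_upwards [h] with y hy
    obtain ⟨β, hβ⟩ := hy w z
    refine ⟨β, ?_⟩
    simp only [σ, Y, hβ]
    simp [covDeriv]
  have hsplit : (fun y => covDeriv A (fun y => Φ y z) y w) = (fun y => Φ y (Y y)) + σ := by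
    ext y
    simp [σ]
  obtain ⟨β, hβ⟩ := h.self_of_nhds.covDeriv_comp hΦ' hY v
  rw [hsplit, covDeriv_add (hΦ'.clm_apply hY) hσ, hβ, map_add, map_add, map_smul,
    hnull.self_of_nhds, form_covDeriv_of_eventually_smul hAB hB hs hn hnull hσ hσn, smul_zero,
    add_zero, add_zero]

theorem gauss_equation (hAB : IsCompatibleAt A B x) (hB : DifferentiableAt ℝ B x)
    (hs : ∀ v w, B x v w = B x w v) (hn : DifferentiableAt ℝ n x)
    (hnull : ∀ᶠ y in 𝓝 x, B y (n y) (n y) = 0) (hA : DifferentiableAt ℝ A x)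
    (hΓ : DifferentiableAt ℝ Γ x) (hΦ : ContDiffAt ℝ 2 Φ x)
    (h : ∀ᶠ y in 𝓝 x, IsInducedAt A Φ n Γ y) (v w z : E) :
    B x (n x) (bundleCurvature A x v w (Φ x z)) =
      B x (n x) (Φ x (bundleCurvature Γ x v w z)) := by
  have key := form_covDeriv_covDeriv_eq hAB hB hs hn hnull hA hΓ hΦ h
  rw [← covDeriv_covDeriv_sub hA (hΦ.clm_apply contDiffAt_const), map_sub, key, key,
    ← covDeriv_covDeriv_sub hΓ (contDiffAt_const (c := z)), map_sub, map_sub]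

end Gauss

section Pullback

variable {E F : Type*} [NormedAddCommGroup E] [NormedSpace ℝ E] [NormedAddCommGroup F]
  [NormedSpace ℝ F] {Γ : F → F →L[ℝ] F →L[ℝ] F} {G : F → F →L[ℝ] F →L[ℝ] ℝ} {φ : E → F} {x : E}

/-- The connection on the pullback of the tangent bundle of `F` along `φ : E → F`. -/
def pullbackConnection (Γ : F → F →L[ℝ] F →L[ℝ] F) (φ : E → F) (x : E) : E →L[ℝ] F →L[ℝ] F :=
  Γ (φ x) ∘L fderiv ℝ φ x

theorem differentiableAt_pullbackConnection (hΓ : DifferentiableAt ℝ Γ (φ x))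
    (hφ : ContDiffAt ℝ 2 φ x) : DifferentiableAt ℝ (pullbackConnection Γ φ) x :=
  (DifferentiableAt.fun_comp' (g := Γ) x hΓ (hφ.differentiableAt two_ne_zero)).clm_comp
    (differentiableAt_fderiv hφ)

theorem bundleCurvature_pullbackConnection (hΓ : DifferentiableAt ℝ Γ (φ x))
    (hφ : ContDiffAt ℝ 2 φ x) (v w : E) (z : F) :
    bundleCurvature (pullbackConnection Γ φ) x v w z =
      bundleCurvature Γ (φ x) (fderiv ℝ φ x v) (fderiv ℝ φ x w) z := by
  have hφ' : DifferentiableAt ℝ φ x := hφ.differentiableAt two_ne_zero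
  have hΓφ : DifferentiableAt ℝ (fun y => Γ (φ y)) x := DifferentiableAt.fun_comp' (g := Γ) x hΓ hφ'
  have fderiv_pullback : ∀ v w, fderiv ℝ (pullbackConnection Γ φ) x v w =
      fderiv ℝ Γ (φ x) (fderiv ℝ φ x v) (fderiv ℝ φ x w)
        + Γ (φ x) (fderiv ℝ (fderiv ℝ φ) x v w) := by
    intro v w
    rw [← fderiv_clm_apply_const (differentiableAt_pullbackConnection hΓ hφ),
      show (fun y => pullbackConnection Γ φ y w) = fun y => Γ (φ y) (fderiv ℝ φ y w) from rfl,
      fderiv_clm_apply_apply hΓφ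
        ((differentiableAt_fderiv hφ).clm_apply (differentiableAt_const w)),
      fderiv_clm_apply_const (differentiableAt_fderiv hφ), fderiv_fun_comp (g := Γ) x hΓ hφ']
    rfl
  simp only [bundleCurvature, fderiv_pullback, fderiv_fderiv_comm hφ v w, add_apply]
  simp [pullbackConnection]

theorem IsCompatibleAt.pullback (hΓG : IsCompatibleAt Γ G (φ x)) (hG : DifferentiableAt ℝ G (φ x))
    (hφ : DifferentiableAt ℝ φ x) :
    IsCompatibleAt (pullbackConnection Γ φ) (fun y => G (φ y)) x := by
  intro v z z'
  rw [fderiv_fun_comp (g := G) x hG hφ]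
  exact hΓG (fderiv ℝ φ x v) z z'

end Pullback

/-! ### The Levi-Civita connection -/

section LeviCivita

variable {F : Type*} [NormedAddCommGroup F] [NormedSpace ℝ F]
  {Γ : F → F →L[ℝ] F →L[ℝ] F} {G : F → F →L[ℝ] F →L[ℝ] ℝ} {y : F}

theorem curvature_eq_bundleCurvature (Γ : F → F →L[ℝ] F →L[ℝ] F) (y u v w : F) :
    curvature Γ y u v w = bundleCurvature Γ y u v w := rfl

theorem curvature_bianchi (hΓ : DifferentiableAt ℝ Γ y)
    (hs : ∀ᶠ y' in 𝓝 y, ∀ v w, Γ y' v w = Γ y' w v) (u v w : F) :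
    curvature Γ y u v w + curvature Γ y v w u + curvature Γ y w u v = 0 := by
  have hd := fderiv_bilin_symm hΓ hs
  have hs0 := hs.self_of_nhds
  simp only [curvature_apply]
  rw [hd u v w, hd v w u, hd w u v, hs0 v w, hs0 w u, hs0 u v]
  abel

theorem christoffel_symm (hG : DifferentiableAt ℝ G y)
    (hs : ∀ᶠ y' in 𝓝 y, ∀ v w, G y' v w = G y' w v) (v w : F) :
    christoffel G y v w = christoffel G y w v := by
  have lower_symm : christoffelLower G y v w = christoffelLower G y w v := by
    ext z
    rw [christoffelLower_apply, christoffelLower_apply, fderiv_bilin_symm hG hs z v w]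
    ring
  rw [christoffel_apply, christoffel_apply, lower_symm]

theorem form_christoffel (hi : (G y).IsInvertible) (v w z : F) :
    G y (christoffel G y v w) z = christoffelLower G y v w z := by
  rw [christoffel_apply, hi.self_apply_inverse]

theorem isCompatibleAt_christoffel (hG : DifferentiableAt ℝ G y)
    (hs : ∀ᶠ y' in 𝓝 y, ∀ v w, G y' v w = G y' w v) (hi : (G y).IsInvertible) :
    IsCompatibleAt (christoffel G) G y := by
  intro v w z
  have hd := fderiv_bilin_symm hG hs
  rw [hs.self_of_nhds w, form_christoffel hi, form_christoffel hi, christoffelLower_apply,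
    christoffelLower_apply, hd v z w, hd z v w, hd w v z]
  ring

theorem eventually_isInvertible {X E : Type*} [TopologicalSpace X] [NormedAddCommGroup E]
    [NormedSpace ℝ E] [CompleteSpace E] {A : X → E →L[ℝ] F} {x : X} (hA : ContinuousAt A x)
    (hi : (A x).IsInvertible) : ∀ᶠ x' in 𝓝 x, (A x').IsInvertible := by
  obtain ⟨e, he⟩ := hi
  exact hA (he ▸ ContinuousLinearEquiv.nhds e)

variable [CompleteSpace F]

set_option maxSynthPendingDepth 4 in
theorem differentiableAt_christoffel (hG : ContDiffAt ℝ 2 G y) (hi : (G y).IsInvertible) :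
    DifferentiableAt ℝ (christoffel G) y := by
  have hinv : DifferentiableAt ℝ (fun y => (G y).inverse) y :=
    ((hi.contDiffAt_map_inverse (n := 1)).differentiableAt one_ne_zero).comp y
      (hG.differentiableAt two_ne_zero)
  have hderiv : DifferentiableAt ℝ (fderiv ℝ G) y := differentiableAt_fderiv hG
  have hflip : DifferentiableAt ℝ (fun y => (fderiv ℝ G y).flip) y :=
    (ContinuousLinearMap.flipₗᵢ ℝ F F (F →L[ℝ] ℝ)).toContinuousLinearEquiv.differentiableAt.comp
      y hderiv
  have hlower : DifferentiableAt ℝ (christoffelLower G) y :=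
    ((hderiv.add hflip).sub ((differentiableAt_const _).clm_comp hflip)).const_smul (1 / 2 : ℝ)
  exact ((ContinuousLinearMap.compL ℝ F (F →L[ℝ] ℝ) F).differentiableAt.comp y hinv).clm_comp
    hlower

theorem eventually_isCompatibleAt_christoffel (hG : ContDiffAt ℝ 1 G y)
    (hs : ∀ᶠ y' in 𝓝 y, ∀ v w, G y' v w = G y' w v) (hi : (G y).IsInvertible) :
    ∀ᶠ y' in 𝓝 y, IsCompatibleAt (christoffel G) G y' := by
  filter_upwards [eventually_differentiableAt hG, hs.eventually_nhds,
    eventually_isInvertible hG.continuousAt hi] with y' using isCompatibleAt_christoffel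

end LeviCivita

section CurvatureTensors

namespace IsAlgebraicCurvature

variable {V : Type*} {T : V → V → V → V → ℝ}

/-- The pair symmetry comes from adding the Bianchi identities of the four cyclic rotations of
`(x, y, z, w)`. -/
theorem of_skew (h₁ : ∀ x y z w, T x y z w = -T y x z w) (h₂ : ∀ x y z w, T x y z w = -T x y w z)
    (h₃ : ∀ x y z w, T x y z w + T y z x w + T z x y w = 0) : IsAlgebraicCurvature T where
  skew := h₁
  pair_symm x y z w := by
    have h₁₂ : ∀ x y z w, T x y z w = T y x w z := fun x y z w => by
      rw [h₁, h₂, neg_neg]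
    linarith [h₃ x y z w, h₃ y z w x, h₃ z w x y, h₃ w x y z, h₂ x y z w, h₂ z w x y,
      h₁₂ y z x w, h₁₂ z x y w, h₁₂ z w y x, h₁₂ w y z x, h₁₂ x z w y, h₁₂ y w x z, h₁₂ x y w z,
      h₂ y z w x, h₂ w x y z, h₁₂ w x z y, h₁ z x y w, h₁ w y z x]
  bianchi := h₃

theorem skew_right (hT : IsAlgebraicCurvature T) (x y z w : V) : T x y z w = -T x y w z := by
  rw [hT.pair_symm, hT.skew, hT.pair_symm]

theorem of_form_curvature {F : Type*} [NormedAddCommGroup F] [NormedSpace ℝ F] [CompleteSpace F]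
    {G : F → F →L[ℝ] F →L[ℝ] ℝ} {y : F} (hG : ContDiffAt ℝ 2 G y)
    (hs : ∀ᶠ y' in 𝓝 y, ∀ v w, G y' v w = G y' w v) (hi : (G y).IsInvertible) :
    IsAlgebraicCurvature fun u v w z => G y (curvature (christoffel G) y u v w) z := by
  have hG1 : ContDiffAt ℝ 1 G y := hG.of_le one_le_two
  have hΓ := differentiableAt_christoffel hG hi
  have hΓs : ∀ᶠ y' in 𝓝 y, ∀ v w, christoffel G y' v w = christoffel G y' w v := by
    filter_upwards [eventually_differentiableAt hG1, hs.eventually_nhds] with y'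
      using christoffel_symm
  refine of_skew (fun u v w z => ?_) (fun u v w z => ?_) (fun u v w z => ?_)
  · rw [curvature_eq_bundleCurvature, bundleCurvature_skew, map_neg, neg_apply]
    rfl
  · rw [hs.self_of_nhds _ w]
    exact bundleCurvature_skewAdjoint (eventually_isCompatibleAt_christoffel hG1 hs hi) hΓ hG
      u v w z
  · simp only [← add_apply, ← map_add, curvature_bianchi hΓ hΓs, map_zero, zero_apply]

end IsAlgebraicCurvature

end CurvatureTensors

/-! ### Sectional curvature and pseudo-spheres -/

section CurvatureTensors

theorem IsAlgebraicCurvature.eq_zero {V : Type*} [AddCommGroup V] {T : V → V → V → V → ℝ}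
    (hT : IsAlgebraicCurvature T)
    (hadd : ∀ x x' y z w, T (x + x') y z w = T x y z w + T x' y z w)
    (hsec : ∀ v w, T v w w v = 0) (x y z w : V) : T x y z w = 0 := by
  have add₂ : ∀ x y y' z w, T x (y + y') z w = T x y z w + T x y' z w := fun x y y' z w => by
    rw [hT.skew, hadd, hT.skew x y, hT.skew x y']; ring
  have add₃ : ∀ x y z z' w, T x y (z + z') w = T x y z w + T x y z' w := fun x y z z' w => by
    rw [hT.pair_symm, hadd, hT.pair_symm x y z, hT.pair_symm x y z']
  have add₄ : ∀ x y z w w', T x y z (w + w') = T x y z w + T x y z w' := fun x y z w w' => by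
    rw [hT.pair_symm, add₂, hT.pair_symm x y z w, hT.pair_symm x y z w']
  have swap_pairs : ∀ x y z w, T x y z w = T w z y x := fun x y z w => by
    rw [hT.pair_symm, hT.skew, hT.skew_right, neg_neg]
  have polarize_inner : ∀ v w z, T v w z v = 0 := by
    intro v w z
    have hsum := hsec v (w + z)
    rw [add₂, add₃, add₃, hsec, hsec, swap_pairs v z] at hsum
    linarith
  have skew_middle : ∀ x y z w, T x y z w = -T x z y w := by
    intro x y z w
    have hsum := polarize_inner (x + w) y z
    rw [hadd, add₄, add₄, polarize_inner, polarize_inner, swap_pairs w] at hsum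
    linarith
  linarith [hT.bianchi x y z w, skew_middle x y z w, skew_middle y x z w, hT.skew z x y w,
    hT.skew y x z w]

variable {F : Type*} [NormedAddCommGroup F] [NormedSpace ℝ F] {b : F →L[ℝ] F →L[ℝ] ℝ}
  {R : F →L[ℝ] F →L[ℝ] F →L[ℝ] F} {c : ℝ}

/-- Along the segment from an arbitrary pair to a nondegenerate one, the product of the
discriminant with the difference of the two sides vanishes identically, and the discriminant does
not; all functions being analytic, the difference vanishes. -/
theorem form_curvature_eq_of_nondegenerate
    (hne : ∃ v w, b v v * b w w - b v w ^ 2 ≠ 0)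
    (hc : ∀ v w, b v v * b w w - b v w ^ 2 ≠ 0 →
      b (R v w w) v = c * (b v v * b w w - b v w ^ 2)) (v w : F) :
    b (R v w w) v = c * (b v v * b w w - b v w ^ 2) := by
  obtain ⟨v₀, w₀, h₀⟩ := hne
  let p : ℝ → F := fun t => v + t • (v₀ - v)
  let q : ℝ → F := fun t => w + t • (w₀ - w)
  let D : ℝ → ℝ := fun t => b (p t) (p t) * b (q t) (q t) - b (p t) (q t) ^ 2
  let T : ℝ → ℝ := fun t => b (R (p t) (q t) (q t)) (p t)
  have hD : AnalyticOnNhd ℝ D Set.univ := fun t _ => by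
    simp only [D, p, q, map_add, map_smul, add_apply, smul_apply, smul_eq_mul]
    fun_prop
  have hT : AnalyticOnNhd ℝ T Set.univ := fun t _ => by
    simp only [T, p, q, map_add, map_smul, add_apply, smul_apply, smul_eq_mul]
    fun_prop
  have hDT : ∀ t, D t = 0 ∨ T t - c * D t = 0 := fun t =>
    or_iff_not_imp_left.2 fun ht => sub_eq_zero.2 (hc _ _ ht)
  rcases hD.eq_zero_or_eq_zero_of_mul_eq_zero (hT.sub (analyticOnNhd_const (v := c) |>.mul hD))
    (fun t _ => mul_eq_zero.2 (hDT t)) isPreconnected_univ with hzero | hzero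
  · exact absurd (by simpa [D, p, q] using hzero 1 trivial) h₀
  · simpa [D, T, p, q, sub_eq_zero] using hzero 0 trivial

theorem form_curvature_eq_of_constant_sectional (hb : ∀ v w, b v w = b w v)
    (hR : IsAlgebraicCurvature fun x y z w => b (R x y z) w)
    (hne : ∃ v w, b v v * b w w - b v w ^ 2 ≠ 0)
    (hc : ∀ v w, b v v * b w w - b v w ^ 2 ≠ 0 →
      b (R v w w) v / (b v v * b w w - b v w ^ 2) = c) (x y z w : F) :
    b (R x y z) w = c * (b y z * b x w - b x z * b y w) := by
  have hsec := form_curvature_eq_of_nondegenerate hne fun v w hvw => (div_eq_iff hvw).1 (hc v w hvw)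
  have hdiff : IsAlgebraicCurvature
      fun x y z w => b (R x y z) w - c * (b y z * b x w - b x z * b y w) := by
    refine ⟨fun x y z w => ?_, fun x y z w => ?_, fun x y z w => ?_⟩
    · linarith [hR.skew x y z w]
    · rw [hR.pair_symm x y z w, hb z x, hb w y, hb w x, hb z y]
      ring
    · rw [hb z x, hb z y, hb y x]
      linarith [hR.bianchi x y z w]
  refine sub_eq_zero.1 (hdiff.eq_zero (fun x x' y z w => ?_) (fun v w => ?_) x y z w)
  · simp only [map_add, add_apply]
    ring
  · rw [hsec, hb w v]
    ring

end CurvatureTensors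

section QuadraticForms

variable {V : Type*} [AddCommGroup V] [Module ℝ V] {Q q : QuadraticForm ℝ V} {ε l : ℝ} {x : V}

theorem exists_smul_map_eq (hε : 0 < ε * Q x) : ∃ r : ℝ, r ≠ 0 ∧ Q (r • x) = ε := by
  have hx : Q x ≠ 0 := right_ne_zero_of_mul hε.ne'
  have hpos : 0 < ε / Q x := by
    rw [← mul_div_mul_right ε (Q x) hx]
    exact div_pos hε (mul_self_pos.2 hx)
  refine ⟨√(ε / Q x), (Real.sqrt_pos.2 hpos).ne', ?_⟩
  rw [QuadraticMap.map_smul, Real.mul_self_sqrt hpos.le, smul_eq_mul, div_mul_cancel₀ _ hx]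

/-- The cone `{0 < ε Q}` is open, so with `x₀` it contains `x₀ ± t y` for some `t ≠ 0`, and
`q (x₀ + t y) + q (x₀ - t y) = 2 q x₀ + 2 t² q y`. -/
theorem eq_zero_of_eq_zero_on_cone {x₀ : V} (h₀ : 0 < ε * Q x₀)
    (h : ∀ x, 0 < ε * Q x → q x = 0) : q = 0 := by
  ext y
  have map_line : ∀ (Q : QuadraticForm ℝ V) (t : ℝ),
      Q (x₀ + t • y) = Q x₀ + t * t * Q y + t * QuadraticMap.polar Q x₀ y := fun Q t => by
    rw [QuadraticMap.map_add Q, QuadraticMap.map_smul, QuadraticMap.polar_smul_right,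
      smul_eq_mul, smul_eq_mul]
  have hcone : ∀ᶠ t : ℝ in 𝓝 0, 0 < ε * Q (x₀ + t • y) := by
    have hcont : Continuous fun t : ℝ => ε * Q (x₀ + t • y) := by
      simp only [map_line]
      fun_prop
    exact hcont.continuousAt.eventually (lt_mem_nhds (by simpa using h₀))
  have hcone_neg : ∀ᶠ t : ℝ in 𝓝 0, 0 < ε * Q (x₀ + (-t) • y) :=
    (continuous_neg.tendsto' (0 : ℝ) 0 neg_zero).eventually hcone
  obtain ⟨t, ⟨ht, ht'⟩, ht0⟩ := (((hcone.and hcone_neg).filter_mono nhdsWithin_le_nhds).and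
    (self_mem_nhdsWithin (a := (0 : ℝ)) (s := {0}ᶜ))).exists
  have hplus := h _ ht
  have hminus := h _ ht'
  rw [map_line, h x₀ h₀] at hplus hminus
  have hy : t * t * q y = 0 := by linarith
  exact (mul_eq_zero.1 hy).resolve_left (mul_self_ne_zero.2 ht0)

theorem eq_smul_of_constant_on_sphere (hε : ε ≠ 0) (hne : ∃ x, Q x = ε)
    (h : ∀ x, Q x = ε → q x = l) : q = (l / ε) • Q := by
  obtain ⟨x₀, hx₀⟩ := hne
  refine sub_eq_zero.1 (eq_zero_of_eq_zero_on_cone (ε := ε) (Q := Q) (x₀ := x₀)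
    (by rw [hx₀]; exact mul_self_pos.2 hε) fun x hx => ?_)
  obtain ⟨r, hr, hrx⟩ := exists_smul_map_eq hx
  have hq : (q - (l / ε) • Q) (r • x) = 0 := by
    simp [h _ hrx, hrx, hε]
  rw [QuadraticMap.map_smul, smul_eq_mul] at hq
  exact (mul_eq_zero.1 hq).resolve_left (mul_self_ne_zero.2 hr)

theorem eq_zero_of_ne_one_of_ne_neg_one (h₁ : ∀ x, Q x ≠ 1) (h₂ : ∀ x, Q x ≠ -1) : Q = 0 := by
  ext x
  rcases lt_trichotomy (Q x) 0 with hx | hx | hx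
  · obtain ⟨r, -, hr⟩ := exists_smul_map_eq (ε := -1) (Q := Q) (x := x) (by linarith)
    exact absurd hr (h₂ _)
  · exact hx
  · obtain ⟨r, -, hr⟩ := exists_smul_map_eq (ε := 1) (Q := Q) (x := x) (by linarith)
    exact absurd hr (h₁ _)

end QuadraticForms

/-! ### The Ricci form of a degenerate metric -/

section SymmetricForms

variable {V : Type*} [AddCommGroup V] [Module ℝ V] {B β : LinearMap.BilinForm ℝ V} {ε l : ℝ}

theorem bilinForm_eq_smul_of_constant_on_sphere (hB : B.IsSymm) (hβ : β.IsSymm) (hε : ε ≠ 0)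
    (hne : ∃ x, B x x = ε) (h : ∀ x, B x x = ε → β x x = l) : β = (l / ε) • B := by
  rw [← QuadraticMap.associated_left_inverse ℝ hβ.eq,
    ← QuadraticMap.associated_left_inverse ℝ hB.eq, ← map_smul]
  exact congrArg _ (eq_smul_of_constant_on_sphere hε hne h)

theorem bilinForm_eq_zero_of_ne_one_of_ne_neg_one (hB : B.IsSymm) (h₁ : ∀ x, B x x ≠ 1)
    (h₂ : ∀ x, B x x ≠ -1) : B = 0 := by
  rw [← QuadraticMap.associated_left_inverse ℝ hB.eq,
    eq_zero_of_ne_one_of_ne_neg_one (Q := B.toQuadraticMap) h₁ h₂, map_zero]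

end SymmetricForms

section Traces

variable {K V : Type*} [Field K] [AddCommGroup V] [Module K V] [FiniteDimensional K V]
  {S T : V →ₗ[K] V}

/-- The form conjugates `S` to the transpose of `T`. -/
theorem trace_eq_of_isAdjointPair {B : LinearMap.BilinForm K V} (hB : B.Nondegenerate)
    (h : LinearMap.IsAdjointPair B B S T) : LinearMap.trace K V S = LinearMap.trace K V T := by
  rw [← LinearMap.trace_conj' S (B.toDual hB), ← LinearMap.trace_transpose' T]
  congr 1
  ext l w
  obtain ⟨v, rfl⟩ := (B.toDual hB).surjective l
  rw [LinearEquiv.conj_apply_apply, LinearEquiv.symm_apply_apply]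
  exact h v w

theorem trace_eq_of_charpoly_eq (h : S.charpoly = T.charpoly) :
    LinearMap.trace K V S = LinearMap.trace K V T := by
  have trace_eq : ∀ S : V →ₗ[K] V, LinearMap.trace K V S = -S.charpoly.nextCoeff := fun S => by
    rw [LinearMap.trace_eq_matrix_trace K (finBasis K V), Matrix.trace_eq_neg_charpoly_nextCoeff,
      LinearMap.charpoly_toMatrix]
  rw [trace_eq, trace_eq, h]

end Traces

section ScreenProjection

variable {E : Type*} [NormedAddCommGroup E] [NormedSpace ℝ E]
  {b : E →L[ℝ] E →L[ℝ] ℝ} {η : E →L[ℝ] ℝ} {ξ : E} {R : E →L[ℝ] E →L[ℝ] E →L[ℝ] E}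

/-- The endomorphism `P` with `g̃(P v, w) = g(v, w)` for `g̃ = g + η ⊗ η`, where `g` is written `b`:
if `ξ` spans the radical and `η ξ = 1`, it is the projection onto `ker η` along `ξ`. -/
def screenProjection (b : E →L[ℝ] E →L[ℝ] ℝ) (η : E →L[ℝ] ℝ) : E →L[ℝ] E :=
  (b + η.smulRight η).inverse ∘L b

theorem form_screenProjection (hi : (b + η.smulRight η).IsInvertible) (v : E) :
    (b + η.smulRight η) (screenProjection b η v) = b v :=
  hi.self_apply_inverse _

theorem screenProjection_apply (hi : (b + η.smulRight η).IsInvertible) (hξ : b ξ = 0)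
    (hη : η ξ = 1) (v : E) : screenProjection b η v = v - η v • ξ := by
  rw [screenProjection, ContinuousLinearMap.comp_apply, hi.inverse_apply_eq]
  ext w
  simp [hξ, hη]

/-- The bilinear form `(x, y) ↦ trace (z ↦ P R(x, z)y)`, which is the Ricci form up to the
contribution of the radical. -/
def screenRicci (b : E →L[ℝ] E →L[ℝ] ℝ) (η : E →L[ℝ] ℝ) (R : E →L[ℝ] E →L[ℝ] E →L[ℝ] E) :
    LinearMap.BilinForm ℝ E :=
  LinearMap.mk₂ ℝ
    (fun x y => LinearMap.trace ℝ E (screenProjection b η ∘L (R x).flip y : E →L[ℝ] E))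
    (fun x x' y => by rw [← map_add]; congr 1; ext; simp)
    (fun a x y => by rw [← map_smul]; congr 1; ext; simp)
    (fun x y y' => by rw [← map_add]; congr 1; ext; simp)
    (fun a x y => by rw [← map_smul]; congr 1; ext; simp)

theorem screenRicci_apply (x y : E) : screenRicci b η R x y =
    LinearMap.trace ℝ E (screenProjection b η ∘L (R x).flip y : E →L[ℝ] E) := rfl

theorem screenRicci_self (hR : IsAlgebraicCurvature fun x y z w => b (R x y z) w) (x : E) :
    screenRicci b η R x x =
      -LinearMap.trace ℝ E (screenProjection b η ∘L (R.flip x).flip x : E →L[ℝ] E) := by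
  rw [screenRicci_apply, ← map_neg]
  congr 1
  ext z
  have hskew : b (R x z x) = -b (R z x x) := ContinuousLinearMap.ext fun w => hR.skew x z x w
  simp [screenProjection, hskew]

variable [FiniteDimensional ℝ E]

theorem screenRicci_isSymm (hi : (b + η.smulRight η).IsInvertible) (hb : ∀ x y, b x y = b y x)
    (hR : IsAlgebraicCurvature fun x y z w => b (R x y z) w) : (screenRicci b η R).IsSymm := by
  let B : LinearMap.BilinForm ℝ E := (b + η.smulRight η).toBilinForm
  have hB : B.IsSymm := ⟨fun x y => by simp [B, hb x y, mul_comm]⟩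
  have hnd : B.Nondegenerate := by
    refine (hB.isRefl.nondegenerate_iff_separatingLeft).2 fun v hv => hi.injective ?_
    rw [map_zero]
    exact ContinuousLinearMap.ext hv
  refine ⟨fun x y => trace_eq_of_isAdjointPair hnd fun v w => ?_⟩
  have form_ricci : ∀ x y v w,
      B ((screenProjection b η ∘L (R x).flip y) v) w = b (R x v y) w := fun x y v w =>
    congrArg (fun l : E →L[ℝ] ℝ => l w) (form_screenProjection hi (R x v y))
  rw [ContinuousLinearMap.coe_coe, ContinuousLinearMap.coe_coe, form_ricci, hB.eq, form_ricci]
  exact hR.pair_symm x v y w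

theorem trace_ricci_eq (hi : (b + η.smulRight η).IsInvertible) (hξ : b ξ = 0) (hη : η ξ = 1)
    (x y : E) :
    LinearMap.trace ℝ E ((R x).flip y : E →L[ℝ] E) = screenRicci b η R x y + η (R x ξ y) := by
  have hsplit : ((R x).flip y : E →ₗ[ℝ] E) =
      (screenProjection b η ∘L (R x).flip y : E →L[ℝ] E)
        + ((η ∘L (R x).flip y : E →L[ℝ] ℝ) : E →ₗ[ℝ] ℝ).smulRight ξ := by
    ext z
    simp [screenProjection_apply hi hξ hη]
  rw [hsplit, map_add, LinearMap.trace_smulRight]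
  rfl

theorem trace_ricci_eq_mul_of_constant_on_sphere (hi : (b + η.smulRight η).IsInvertible)
    (hb : ∀ x y, b x y = b y x) (hξ : b ξ = 0) (hη : η ξ = 1)
    (hR : IsAlgebraicCurvature fun x y z w => b (R x y z) w) {c : ℝ}
    (hc : ∀ x y, η (R x ξ y) = c * b x y) {ε l : ℝ} (hε : ε ≠ 0) (hne : ∃ x, b x x = ε)
    (hJ : ∀ x, b x x = ε →
      LinearMap.trace ℝ E (screenProjection b η ∘L (R.flip x).flip x : E →L[ℝ] E) = l) (x y : E) :
    LinearMap.trace ℝ E ((R x).flip y : E →L[ℝ] E) = (-l / ε + c) * b x y := by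
  have hscreen : screenRicci b η R = (-l / ε) • b.toBilinForm :=
    bilinForm_eq_smul_of_constant_on_sphere ⟨hb⟩ (screenRicci_isSymm hi hb hR) hε hne fun x hx => by
      rw [screenRicci_self hR, hJ x hx]
  rw [trace_ricci_eq hi hξ hη, hscreen, hc, add_mul]
  rfl

end ScreenProjection

/-! ### Hyperplanes and transversal vectors -/

section Invertibility

variable {E F : Type*} [NormedAddCommGroup E] [NormedSpace ℝ E] [FiniteDimensional ℝ E]
  [NormedAddCommGroup F] [NormedSpace ℝ F] [FiniteDimensional ℝ F]

theorem isInvertible_of_injective {A : E →L[ℝ] F} (hA : Function.Injective A)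
    (hdim : finrank ℝ E = finrank ℝ F) : A.IsInvertible :=
  ⟨(LinearEquiv.ofInjectiveOfFinrankEq (A : E →ₗ[ℝ] F) hA hdim).toContinuousLinearEquiv, by
    ext; rfl⟩

theorem isInvertible_of_nondegenerate {b : E →L[ℝ] E →L[ℝ] ℝ}
    (hnd : ∀ v, (∀ w, b v w = 0) → v = 0) : b.IsInvertible := by
  have hdim : finrank ℝ E = finrank ℝ (E →L[ℝ] ℝ) := by
    rw [← (LinearMap.toContinuousLinearMap (𝕜 := ℝ) (E := E) (F' := ℝ)).finrank_eq]
    exact Subspace.dual_finrank_eq.symm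
  have hinj : Function.Injective b := (injective_iff_map_eq_zero b).2 fun v hv =>
    hnd v fun w => by rw [hv, _root_.zero_apply]
  exact isInvertible_of_injective hinj hdim

end Invertibility

theorem differentiableAt_inverse {P E F : Type*} [NormedAddCommGroup P] [NormedSpace ℝ P]
    [NormedAddCommGroup E] [NormedSpace ℝ E] [CompleteSpace E] [NormedAddCommGroup F]
    [NormedSpace ℝ F] {A : P → E →L[ℝ] F} {x : P} (hA : DifferentiableAt ℝ A x)
    (hi : (A x).IsInvertible) : DifferentiableAt ℝ (fun x => (A x).inverse) x :=
  ((hi.contDiffAt_map_inverse (n := 1)).differentiableAt one_ne_zero).comp x hA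

section Splittings

variable {E F : Type*} [NormedAddCommGroup E] [NormedSpace ℝ E] [NormedAddCommGroup F]
  [NormedSpace ℝ F] {A : E →L[ℝ] F} {n : F}

/-- The map `(w, t) ↦ A w + t n`; it is invertible if `A` is the inclusion of a hyperplane and `n`
is transversal to it. -/
def splitting (A : E →L[ℝ] F) (n : F) : E × ℝ →L[ℝ] F :=
  A.coprod (ContinuousLinearMap.toSpanSingleton ℝ n)

/-- The component in `E` of a vector of `F = A(E) ⊕ ℝ n`. -/
def tangentialPart (A : E →L[ℝ] F) (n : F) : F →L[ℝ] E :=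
  ContinuousLinearMap.fst ℝ E ℝ ∘L (splitting A n).inverse

/-- The coefficient of `n` of a vector of `F = A(E) ⊕ ℝ n`. -/
def transversalPart (A : E →L[ℝ] F) (n : F) : F →L[ℝ] ℝ :=
  ContinuousLinearMap.snd ℝ E ℝ ∘L (splitting A n).inverse

theorem splitting_apply (w : E) (t : ℝ) : splitting A n (w, t) = A w + t • n := rfl

theorem isInvertible_splitting [FiniteDimensional ℝ E] [FiniteDimensional ℝ F]
    (hA : Function.Injective A) (hn : ∀ w, A w ≠ n) (hdim : finrank ℝ F = finrank ℝ E + 1) :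
    (splitting A n).IsInvertible := by
  refine isInvertible_of_injective ((injective_iff_map_eq_zero _).2 fun p hp => ?_) (by simp [hdim])
  obtain ⟨w, t⟩ := p
  rw [splitting_apply] at hp
  have ht : t = 0 := by
    by_contra ht
    refine hn (-t⁻¹ • w) ?_
    rw [map_smul, eq_neg_of_add_eq_zero_left hp, neg_smul_neg, inv_smul_smul₀ ht]
  rw [ht, zero_smul, add_zero, ← map_zero A] at hp
  rw [hA hp, ht, Prod.mk_zero_zero]

theorem exists_isInvertible_splitting [FiniteDimensional ℝ E] [FiniteDimensional ℝ F]
    (hA : Function.Injective A) (hdim : finrank ℝ F = finrank ℝ E + 1) :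
    ∃ n, (splitting A n).IsInvertible := by
  by_contra! h
  have hsurj : Function.Surjective A := fun n => by
    by_contra! hn
    exact h n (isInvertible_splitting hA hn hdim)
  have := LinearMap.finrank_le_finrank_of_surjective (f := (A : E →ₗ[ℝ] F)) hsurj
  omega

theorem tangentialPart_map (hi : (splitting A n).IsInvertible) (w : E) :
    tangentialPart A n (A w) = w := by
  have hw : (splitting A n).inverse (A w) = (w, 0) :=
    hi.inverse_apply_eq.2 (by rw [splitting_apply, zero_smul, add_zero])
  rw [tangentialPart, ContinuousLinearMap.comp_apply, hw, ContinuousLinearMap.coe_fst']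

theorem tangentialPart_self (hi : (splitting A n).IsInvertible) : tangentialPart A n n = 0 := by
  have hn : (splitting A n).inverse n = (0, 1) :=
    hi.inverse_apply_eq.2 (by rw [splitting_apply, map_zero, one_smul, zero_add])
  rw [tangentialPart, ContinuousLinearMap.comp_apply, hn, ContinuousLinearMap.coe_fst']

theorem transversalPart_map (hi : (splitting A n).IsInvertible) (w : E) :
    transversalPart A n (A w) = 0 := by
  have hw : (splitting A n).inverse (A w) = (w, 0) :=
    hi.inverse_apply_eq.2 (by rw [splitting_apply, zero_smul, add_zero])
  rw [transversalPart, ContinuousLinearMap.comp_apply, hw, ContinuousLinearMap.coe_snd']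

theorem map_tangentialPart_add (hi : (splitting A n).IsInvertible) (v : F) :
    A (tangentialPart A n v) + transversalPart A n v • n = v :=
  hi.self_apply_inverse v

theorem eq_tangentialPart (hi : (splitting A n).IsInvertible) {τ : F →L[ℝ] E}
    (hA : ∀ w, τ (A w) = w) (hn : τ n = 0) : τ = tangentialPart A n := by
  ext v
  conv_lhs => rw [← map_tangentialPart_add hi v]
  rw [map_add, hA, map_smul, hn, smul_zero, add_zero]

variable {P : Type*} [NormedAddCommGroup P] [NormedSpace ℝ P] {A : P → E →L[ℝ] F} {n : P → F}
  {x : P}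

theorem differentiableAt_splitting (hA : DifferentiableAt ℝ A x) (hn : DifferentiableAt ℝ n x) :
    DifferentiableAt ℝ (fun x => splitting (A x) (n x)) x :=
  (ContinuousLinearMap.coprodEquivL (𝕜 := ℝ) (S := ℝ)).differentiableAt.comp x
    (hA.prodMk ((ContinuousLinearMap.toSpanSingletonCLE (𝕜 := ℝ)).differentiableAt.comp x hn))

variable [CompleteSpace E]

theorem differentiableAt_tangentialPart (hA : DifferentiableAt ℝ A x) (hn : DifferentiableAt ℝ n x)
    (hi : (splitting (A x) (n x)).IsInvertible) :
    DifferentiableAt ℝ (fun x => tangentialPart (A x) (n x)) x :=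
  (differentiableAt_const _).clm_comp
    (differentiableAt_inverse (differentiableAt_splitting hA hn) hi)

theorem differentiableAt_transversalPart (hA : DifferentiableAt ℝ A x)
    (hn : DifferentiableAt ℝ n x) (hi : (splitting (A x) (n x)).IsInvertible) :
    DifferentiableAt ℝ (fun x => transversalPart (A x) (n x)) x :=
  (differentiableAt_const _).clm_comp
    (differentiableAt_inverse (differentiableAt_splitting hA hn) hi)

theorem eventually_isInvertible_splitting (hA : DifferentiableAt ℝ A x)
    (hn : DifferentiableAt ℝ n x) (hi : (splitting (A x) (n x)).IsInvertible) :
    ∀ᶠ y in 𝓝 x, (splitting (A y) (n y)).IsInvertible :=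
  eventually_isInvertible (differentiableAt_splitting hA hn).continuousAt hi

end Splittings

theorem mem_radical_iff {V : Type*} [AddCommGroup V] [Module ℝ V] [TopologicalSpace V]
    {b : V →L[ℝ] V →L[ℝ] ℝ} {v : V} : v ∈ radical b ↔ ∀ w, b v w = 0 := by
  rw [radical, LinearMap.mem_ker]
  exact ContinuousLinearMap.ext_iff

theorem exists_smul_eq_of_mem_radical {V : Type*} [AddCommGroup V] [Module ℝ V]
    [TopologicalSpace V] {b : V →L[ℝ] V →L[ℝ] ℝ} {ξ v : V} (hrad : finrank ℝ (radical b) = 1)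
    (hξ : ξ ∈ radical b) (hξ0 : ξ ≠ 0) (hv : v ∈ radical b) : ∃ a : ℝ, a • ξ = v := by
  obtain ⟨a, ha⟩ := (finrank_eq_one_iff_of_nonzero' (⟨ξ, hξ⟩ : radical b)
    (Subtype.coe_ne_coe.1 hξ0)).1 hrad ⟨v, hv⟩
  exact ⟨a, congrArg Subtype.val ha⟩

theorem isInvertible_add_smulRight {V : Type*} [NormedAddCommGroup V] [NormedSpace ℝ V]
    [FiniteDimensional ℝ V] {b : V →L[ℝ] V →L[ℝ] ℝ} {η : V →L[ℝ] ℝ} {ξ : V}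
    (hb : ∀ x y, b x y = b y x) (hξ : b ξ = 0) (hη : η ξ = 1) (hrad : finrank ℝ (radical b) = 1) :
    (b + η.smulRight η).IsInvertible := by
  refine isInvertible_of_nondegenerate fun v hv => ?_
  have hηv : η v = 0 := by simpa [hb v, hξ, hη] using hv ξ
  have hvrad : v ∈ radical b := mem_radical_iff.2 fun w => by simpa [hηv] using hv w
  have hξ0 : ξ ≠ 0 := fun h => by simp [h] at hη
  obtain ⟨a, rfl⟩ := exists_smul_eq_of_mem_radical hrad hξ hξ0 hvrad
  rw [map_smul, hη, smul_eq_mul, mul_one] at hηv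
  rw [hηv, zero_smul]

section NullTransversals

variable {V W : Type*} [AddCommGroup V] [Module ℝ V] [TopologicalSpace V]
  [AddCommGroup W] [Module ℝ W] [TopologicalSpace W]

/-- A vector `ξ` of the radical of the form induced by `b` on `A : W → V`, and a null vector `n` of
`V` orthogonal to the screen `S` with `b(n, A ξ) = 1`. This is the notion of a normalizing pair of
linear algebra, which applies in a chart as well as in the tangent spaces. -/
structure IsNullTransversalPair (b : V →L[ℝ] V →L[ℝ] ℝ) (A : W →L[ℝ] V) (S : Submodule ℝ W)
    (ξ : W) (n : V) : Prop where
  form_radical : ∀ w, b (A ξ) (A w) = 0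
  null : b n n = 0
  orthogonal : ∀ s ∈ S, b n (A s) = 0
  normalized : b n (A ξ) = 1

variable {b : V →L[ℝ] V →L[ℝ] ℝ} {A : W →L[ℝ] V} {S : Submodule ℝ W} {ξ ξ' : W} {m n n' : V}

/-- In the plane spanned by the null vector `A ξ` and `m`, the second null line is spanned by
`m - ½ b(m, m) A ξ`. -/
theorem isNullTransversalPair_of_form_eq_one (hb : ∀ v w, b v w = b w v)
    (hξ : ∀ w, b (A ξ) (A w) = 0) (hS : ∀ s ∈ S, b m (A s) = 0) (hm : b m (A ξ) = 1) :
    IsNullTransversalPair b A S ξ (m - (b m m / 2) • A ξ) where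
  form_radical := hξ
  null := by
    simp only [map_sub, map_smul, _root_.sub_apply, _root_.smul_apply, smul_eq_mul, hξ,
      hb (A ξ) m, hm]
    ring
  orthogonal s hs := by simp [hξ, hS s hs]
  normalized := by simp [hξ, hm]

namespace IsNullTransversalPair

theorem mem_radical (h : IsNullTransversalPair b A S ξ n) : ξ ∈ radical (pullbackForm b A) :=
  mem_radical_iff.2 h.form_radical

theorem ne_zero (h : IsNullTransversalPair b A S ξ n) : ξ ≠ 0 := fun hξ => by
  simpa [hξ] using h.normalized

theorem map_ne (h : IsNullTransversalPair b A S ξ n) (hb : ∀ v w, b v w = b w v) (w : W) :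
    A w ≠ n := by
  rintro rfl
  simpa [hb (A w), h.form_radical] using h.normalized

theorem smul (h : IsNullTransversalPair b A S ξ n) {a : ℝ} (ha : a ≠ 0) :
    IsNullTransversalPair b A S (a • ξ) (a⁻¹ • n) where
  form_radical w := by simp [h.form_radical]
  null := by simp [h.null]
  orthogonal s hs := by simp [h.orthogonal s hs]
  normalized := by simp [h.normalized, ha]

variable (h : IsNullTransversalPair b A S ξ n) (hb : ∀ v w, b v w = b w v)
  (hrad : finrank ℝ (radical (pullbackForm b A)) = 1)
  (hS : IsCompl (radical (pullbackForm b A)) S)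
  (hspan : ∀ v, ∃ w, ∃ t : ℝ, A w + t • n = v)
include h hb hrad hS hspan

theorem transversal_eq (h' : IsNullTransversalPair b A S ξ n') : n' = n := by
  have horth : ∀ w, b (n' - n) (A w) = 0 := fun w => by
    obtain ⟨r, hr, s, hs, rfl⟩ := Submodule.mem_sup.1 (hS.sup_eq_top ▸ Submodule.mem_top (x := w))
    obtain ⟨a, rfl⟩ := exists_smul_eq_of_mem_radical hrad h.mem_radical h.ne_zero hr
    simp [h.orthogonal s hs, h'.orthogonal s hs, h.normalized, h'.normalized]
  obtain ⟨w, t, hw⟩ := hspan (n' - n)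
  have ht : t = 0 := by
    simpa [← hw, hb (A w), h.form_radical, h.normalized] using horth ξ
  rw [ht, zero_smul, add_zero] at hw
  obtain ⟨a, rfl⟩ := exists_smul_eq_of_mem_radical hrad h.mem_radical h.ne_zero
    (mem_radical_iff.2 fun w' => (congrArg (b · (A w')) hw).trans (horth w'))
  rw [map_smul] at hw
  have hnull : b (n + a • A ξ) (n + a • A ξ) = 0 := by rw [hw, add_sub_cancel, h'.null]
  have ha : a = 0 := by
    simpa [h.null, h.normalized, h.form_radical, hb (A ξ) n] using hnull
  rw [← sub_eq_zero, ← hw, ha, zero_smul]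

theorem exists_smul_eq (h' : IsNullTransversalPair b A S ξ' n') : ∃ a : ℝ, a • n = n' := by
  obtain ⟨a, rfl⟩ := exists_smul_eq_of_mem_radical hrad h'.mem_radical h'.ne_zero h.mem_radical
  have ha : a ≠ 0 := fun ha => h.ne_zero (by rw [ha, zero_smul])
  exact ⟨a, by rw [← h.transversal_eq hb hrad hS hspan (h'.smul ha), smul_inv_smul₀ ha]⟩

end IsNullTransversalPair

end NullTransversals

section Transport

variable {V W V' W' : Type*} [AddCommGroup V] [Module ℝ V] [TopologicalSpace V]
  [AddCommGroup W] [Module ℝ W] [TopologicalSpace W] [AddCommGroup V'] [Module ℝ V']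
  [TopologicalSpace V'] [AddCommGroup W'] [Module ℝ W'] [TopologicalSpace W']
  {b : V →L[ℝ] V →L[ℝ] ℝ} {A : W →L[ℝ] V} {b' : V' →L[ℝ] V' →L[ℝ] ℝ} {A' : W' →L[ℝ] V'}
  {κ : W ≃L[ℝ] W'} {μ : V ≃L[ℝ] V'}

theorem isNullTransversalPair_map_iff (hb : ∀ v w, b' (μ v) (μ w) = b v w)
    (hA : ∀ w, A' (κ w) = μ (A w)) {S : Submodule ℝ W} {ξ : W} {n : V} :
    IsNullTransversalPair b' A' (S.map κ.toLinearEquiv.toLinearMap) (κ ξ) (μ n) ↔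
      IsNullTransversalPair b A S ξ n := by
  have hrad : (∀ w, b' (A' (κ ξ)) (A' w) = 0) ↔ ∀ w, b (A ξ) (A w) = 0 := by
    rw [κ.surjective.forall]
    simp only [hA, hb]
  have horth : (∀ s ∈ S.map κ.toLinearEquiv.toLinearMap, b' (μ n) (A' s) = 0) ↔
      ∀ s ∈ S, b n (A s) = 0 := by
    rw [κ.surjective.forall]
    simp [hA, hb]
  have hone : b' (μ n) (A' (κ ξ)) = b n (A ξ) := by rw [hA, hb]
  constructor
  · exact fun h => ⟨hrad.1 h.form_radical, hb n n ▸ h.null, horth.1 h.orthogonal,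
      hone ▸ h.normalized⟩
  · exact fun h => ⟨hrad.2 h.form_radical, (hb n n).trans h.null, horth.2 h.orthogonal,
      hone.trans h.normalized⟩

end Transport

section NullVectors

variable {E F : Type*} [NormedAddCommGroup E] [NormedSpace ℝ E] [NormedAddCommGroup F]
  [NormedSpace ℝ F] {b : F →L[ℝ] F →L[ℝ] ℝ} {A : E →L[ℝ] F} {S : Submodule ℝ E} {ξ : E}
  {α ν : F →L[ℝ] ℝ}

/-- The null vector `m - b(m, m) / (2 b(m, r)) r` for the metric duals `m` of `α` and `r` of `ν`. If
`ν` annihilates a lightlike hyperplane, then `r` spans its radical, and if `α` moreover annihilates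
the screen, then this vector spans the null transversal line. -/
def nullVector (b : F →L[ℝ] F →L[ℝ] ℝ) (α ν : F →L[ℝ] ℝ) : F :=
  let m := b.inverse α
  let r := b.inverse ν
  m - (b m m / (2 * b m r)) • r

theorem mul_form_inverse_inverse (hi : b.IsInvertible) {a : ℝ} {v : F} (hν : b v = a • ν)
    (hα : α v = 1) : a * b (b.inverse α) (b.inverse ν) = 1 := by
  rw [hi.self_apply_inverse, ← smul_eq_mul, ← map_smul, ← map_smul, ← hν, hi.inverse_apply_self, hα]

theorem isNullTransversalPair_nullVector (hi : b.IsInvertible) (hb : ∀ v w, b v w = b w v) {a : ℝ}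
    (hξ : ∀ w, b (A ξ) (A w) = 0) (hν : b (A ξ) = a • ν) (hα : ∀ s ∈ S, α (A s) = 0)
    (hαξ : α (A ξ) = 1) : IsNullTransversalPair b A S ξ (nullVector b α ν) := by
  have hr : A ξ = a • b.inverse ν := by rw [← map_smul, ← hν, hi.inverse_apply_self]
  have har := mul_form_inverse_inverse hi hν hαξ
  have hnull : nullVector b α ν =
      b.inverse α - (b (b.inverse α) (b.inverse α) / 2) • A ξ := by
    rw [nullVector, hr, smul_smul, eq_div_of_mul_eq (right_ne_zero_of_mul_eq_one har) har]
    ring_nf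
  rw [hnull]
  refine isNullTransversalPair_of_form_eq_one hb hξ ?_ ?_ <;> rwa [hi.self_apply_inverse]

namespace IsNullTransversalPair

variable {D : Type*} [NormedAddCommGroup D] [NormedSpace ℝ D] {X : D →L[ℝ] E} {n f₀ : F} {e₀ : E}
  (h : IsNullTransversalPair b A (LinearMap.range (X : D →ₗ[ℝ] E)) ξ n)
  (hA : (splitting A f₀).IsInvertible) (hX : (splitting X e₀).IsInvertible)
include h hA hX

theorem exists_transversalPart_eq_one : ∃ ξ', (∀ w, b (A ξ') (A w) = 0) ∧
    (∃ a : ℝ, b (A ξ') = a • transversalPart A f₀) ∧ transversalPart X e₀ ξ' = 1 := by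
  have hξ0 : transversalPart X e₀ ξ ≠ 0 := fun h0 => by
    have hξX : X (tangentialPart X e₀ ξ) = ξ := by simpa [h0] using map_tangentialPart_add hX ξ
    exact zero_ne_one ((h.orthogonal ξ ⟨_, hξX⟩).symm.trans h.normalized)
  refine ⟨(transversalPart X e₀ ξ)⁻¹ • ξ, by simp [h.form_radical],
    ⟨(transversalPart X e₀ ξ)⁻¹ * b (A ξ) f₀, ContinuousLinearMap.ext fun v => ?_⟩, by simp [hξ0]⟩
  have hv : b (A ξ) v = transversalPart A f₀ v * b (A ξ) f₀ := by
    conv_lhs => rw [← map_tangentialPart_add hA v]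
    simp [h.form_radical]
  simp only [map_smul, _root_.smul_apply, smul_eq_mul, hv]
  ring

variable (hi : b.IsInvertible)
include hi

theorem form_inverse_transversalPart_ne_zero :
    b (b.inverse (transversalPart X e₀ ∘L tangentialPart A f₀))
      (b.inverse (transversalPart A f₀)) ≠ 0 := by
  obtain ⟨ξ', -, ⟨a, ha⟩, hξ'⟩ := h.exists_transversalPart_eq_one hA hX
  refine right_ne_zero_of_mul_eq_one (mul_form_inverse_inverse hi ha ?_)
  rw [ContinuousLinearMap.comp_apply, tangentialPart_map hA, hξ']

/-- With `l` the coefficient of `e₀` in `E = X(D) ⊕ ℝ e₀` and `τ` the projection to `E` in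
`F = A(E) ⊕ ℝ f₀`, the form `l ∘ τ` annihilates the screen and the coefficient of `f₀` annihilates
the hyperplane. -/
theorem exists_nullVector (hb : ∀ v w, b v w = b w v) :
    ∃ ξ, IsNullTransversalPair b A (LinearMap.range (X : D →ₗ[ℝ] E)) ξ
      (nullVector b (transversalPart X e₀ ∘L tangentialPart A f₀) (transversalPart A f₀)) := by
  obtain ⟨ξ', hrad, ⟨a, ha⟩, hξ'⟩ := h.exists_transversalPart_eq_one hA hX
  refine ⟨ξ', isNullTransversalPair_nullVector hi hb hrad ha ?_ ?_⟩
  · rintro _ ⟨d, rfl⟩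
    simp [tangentialPart_map hA, transversalPart_map hX]
  · rw [ContinuousLinearMap.comp_apply, tangentialPart_map hA, hξ']

end IsNullTransversalPair

variable {P : Type*} [NormedAddCommGroup P] [NormedSpace ℝ P] {x : P}

theorem differentiableAt_nullVector [CompleteSpace F] {b : P → F →L[ℝ] F →L[ℝ] ℝ}
    {α ν : P → F →L[ℝ] ℝ} (hb : DifferentiableAt ℝ b x) (hi : (b x).IsInvertible)
    (hα : DifferentiableAt ℝ α x) (hν : DifferentiableAt ℝ ν x)
    (hne : b x ((b x).inverse (α x)) ((b x).inverse (ν x)) ≠ 0) :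
    DifferentiableAt ℝ (fun x => nullVector (b x) (α x) (ν x)) x := by
  have hm := (differentiableAt_inverse hb hi).clm_apply hα
  have hr := (differentiableAt_inverse hb hi).clm_apply hν
  have hmm := (hb.clm_apply hm).clm_apply hm
  have hmr := ((hb.clm_apply hm).clm_apply hr).const_mul 2
  simp only [nullVector, div_eq_mul_inv]
  exact hm.fun_sub ((hmm.fun_mul (hmr.fun_inv (mul_ne_zero two_ne_zero hne))).fun_smul hr)

theorem exists_differentiableAt_isNullTransversalPair {D : Type*} [NormedAddCommGroup D]
    [NormedSpace ℝ D] [FiniteDimensional ℝ D] [FiniteDimensional ℝ E] [FiniteDimensional ℝ F]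
    {b : P → F →L[ℝ] F →L[ℝ] ℝ} {A : P → E →L[ℝ] F} {X : P → D →L[ℝ] E}
    (hb : DifferentiableAt ℝ b x) (hA : DifferentiableAt ℝ A x) (hX : DifferentiableAt ℝ X x)
    (hbi : (b x).IsInvertible) (hAi : Function.Injective (A x)) (hXi : Function.Injective (X x))
    (hF : finrank ℝ F = finrank ℝ E + 1) (hE : finrank ℝ E = finrank ℝ D + 1)
    (hs : ∀ᶠ y in 𝓝 x, ∀ v w, b y v w = b y w v)
    (h : ∀ᶠ y in 𝓝 x, ∃ ξ n,
      IsNullTransversalPair (b y) (A y) (LinearMap.range (X y : D →ₗ[ℝ] E)) ξ n) :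
    ∃ n : P → F, DifferentiableAt ℝ n x ∧ ∀ᶠ y in 𝓝 x, ∃ ξ,
      IsNullTransversalPair (b y) (A y) (LinearMap.range (X y : D →ₗ[ℝ] E)) ξ (n y) := by
  have : CompleteSpace F := FiniteDimensional.complete ℝ F
  have : CompleteSpace E := FiniteDimensional.complete ℝ E
  have : CompleteSpace D := FiniteDimensional.complete ℝ D
  obtain ⟨f₀, hf₀⟩ := exists_isInvertible_splitting hAi hF
  obtain ⟨e₀, he₀⟩ := exists_isInvertible_splitting hXi hE
  have hc₀ : DifferentiableAt ℝ (fun _ : P => f₀) x := differentiableAt_const _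
  have hc₁ : DifferentiableAt ℝ (fun _ : P => e₀) x := differentiableAt_const _
  refine ⟨fun y => nullVector (b y) (transversalPart (X y) e₀ ∘L tangentialPart (A y) f₀)
    (transversalPart (A y) f₀), differentiableAt_nullVector hb hbi ?_ ?_ ?_, ?_⟩
  · exact (differentiableAt_transversalPart hX hc₁ he₀).clm_comp
      (differentiableAt_tangentialPart hA hc₀ hf₀)
  · exact differentiableAt_transversalPart hA hc₀ hf₀
  · obtain ⟨ξ, n, hn⟩ := h.self_of_nhds
    exact hn.form_inverse_transversalPart_ne_zero hf₀ he₀ hbi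
  · filter_upwards [h, hs, eventually_isInvertible hb.continuousAt hbi,
      eventually_isInvertible_splitting hA hc₀ hf₀,
      eventually_isInvertible_splitting hX hc₁ he₀] with y ⟨ξ, n, hn⟩ hs hi hAi hXi
    exact hn.exists_nullVector hAi hXi hi hs

theorem exists_isNullTransversalPair [FiniteDimensional ℝ E] [FiniteDimensional ℝ F]
    (hb : ∀ v w, b v w = b w v) (hi : b.IsInvertible) (hA : Function.Injective A)
    (hdim : finrank ℝ F = finrank ℝ E + 1) (hrad : finrank ℝ (radical (pullbackForm b A)) = 1)
    (hS : Disjoint (radical (pullbackForm b A)) S) : ∃ ξ n, IsNullTransversalPair b A S ξ n := by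
  obtain ⟨⟨ξ, hξ⟩, hξ0, -⟩ := finrank_eq_one_iff'.1 hrad
  have hξS : ξ ∉ S := fun h => hξ0 (Subtype.ext (Submodule.disjoint_def.1 hS ξ hξ h))
  obtain ⟨l, hl, hlS⟩ := Submodule.exists_le_ker_of_notMem hξS
  obtain ⟨f₀, hf₀⟩ := exists_isInvertible_splitting hA hdim
  have hm : ∀ w, b (b.inverse (LinearMap.toContinuousLinearMap l ∘L tangentialPart A f₀)) (A w) =
      l w := fun w => by
    rw [hi.self_apply_inverse, ContinuousLinearMap.comp_apply, tangentialPart_map hf₀,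
      LinearMap.coe_toContinuousLinearMap']
  refine ⟨ξ, _, isNullTransversalPair_of_form_eq_one (m := (l ξ)⁻¹ •
    b.inverse (LinearMap.toContinuousLinearMap l ∘L tangentialPart A f₀)) hb
    (mem_radical_iff.1 hξ) (fun s hs => ?_) ?_⟩
  · rw [map_smul, _root_.smul_apply, hm, LinearMap.mem_ker.1 (hlS hs), smul_zero]
  · rw [map_smul, _root_.smul_apply, hm, smul_eq_mul, inv_mul_cancel₀ hl]

end NullVectors

/-! ### Charts -/

section Charts

open ScreenDistribution (mapInChart)

theorem eventually_nhds_chartAt_iff {E M : Type*} [TopologicalSpace E] [TopologicalSpace M]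
    [ChartedSpace E M] {p : M} {P : E → Prop} :
    (∀ᶠ x in 𝓝 (chartAt E p p), P x) ↔ ∀ᶠ q in 𝓝 p, P (chartAt E p q) := by
  rw [← (chartAt E p).map_nhds_eq (mem_chart_source E p), Filter.eventually_map]

variable {E : Type*} [NormedAddCommGroup E] [NormedSpace ℝ E]
  {F : Type*} [NormedAddCommGroup F] [NormedSpace ℝ F]
  {M : Type*} [TopologicalSpace M] [ChartedSpace E M]
  {N : Type*} [TopologicalSpace N] [ChartedSpace F N] {f : M → N}

omit [NormedSpace ℝ E] [NormedSpace ℝ F] in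
theorem mapInChart_chartAt {p q : M} (hq : q ∈ (chartAt E p).source) :
    mapInChart (E := E) (F := F) f p (chartAt E p q) = chartAt F (f p) (f q) := by
  rw [mapInChart, (chartAt E p).left_inv hq]

theorem contDiffAt_mapInChart (hf : ContMDiff 𝓘(ℝ, E) 𝓘(ℝ, F) ∞ f) (p : M) :
    ContDiffAt ℝ ∞ (mapInChart (E := E) (F := F) f p) (chartAt E p p) := by
  have hchart := (contMDiffAt_iff.1 (hf p)).2
  simp only [modelWithCornersSelf_coe, Set.range_id, contDiffWithinAt_univ] at hchart
  exact hchart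

variable [IsManifold 𝓘(ℝ, E) ∞ M] [IsManifold 𝓘(ℝ, F) ∞ N]

/-- The identification with the model space `E` of the tangent space at `q` given by the derivative
of the preferred chart at `p`. -/
def tangentChart (p : M) {q : M} (hq : q ∈ (chartAt E p).source) :
    TangentSpace 𝓘(ℝ, E) q ≃L[ℝ] E :=
  (mdifferentiable_chart (I := 𝓘(ℝ, E)) p).mfderiv hq

theorem tangentChart_self (p : M) (v : TangentSpace 𝓘(ℝ, E) p) :
    tangentChart p (mem_chart_source E p) v = (v : E) := by
  change (mfderiv 𝓘(ℝ, E) 𝓘(ℝ, E) (chartAt E p) p v : E) = v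
  rw [mfderiv_chartAt_eq_tangentCoordChange (mem_chart_source E p)]
  exact tangentCoordChange_self (I := 𝓘(ℝ, E)) (by simp)

theorem mfderiv_chartAt_symm_tangentChart (p : M) {y : E} (hy : y ∈ (chartAt E p).target)
    (v : TangentSpace 𝓘(ℝ, E) ((chartAt E p).symm y)) :
    mfderiv 𝓘(ℝ, E) 𝓘(ℝ, E) (chartAt E p).symm y
      (tangentChart p ((chartAt E p).map_target hy) v : E) = v := by
  have hsymm := ((mdifferentiable_chart (I := 𝓘(ℝ, E)) p).mfderiv
    ((chartAt E p).map_target hy)).symm_apply_apply v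
  have hbase : ∀ y', y' = y → ∀ w : E, (mfderiv 𝓘(ℝ, E) 𝓘(ℝ, E) (chartAt E p).symm y' w : E) =
      (mfderiv 𝓘(ℝ, E) 𝓘(ℝ, E) (chartAt E p).symm y w : E) := by
    rintro _ rfl w
    rfl
  exact (hbase _ ((chartAt E p).right_inv hy) _).symm.trans hsymm

theorem metricInChart_tangentChart
    (g : ∀ q : M, TangentSpace 𝓘(ℝ, E) q →L[ℝ] TangentSpace 𝓘(ℝ, E) q →L[ℝ] ℝ) (p : M) {q : M}
    (hq : q ∈ (chartAt E p).source) (v w : TangentSpace 𝓘(ℝ, E) q) :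
    metricInChart g p (chartAt E p q) (tangentChart p hq v) (tangentChart p hq w) = g q v w := by
  obtain ⟨y, hy, rfl⟩ : ∃ y ∈ (chartAt E p).target, (chartAt E p).symm y = q :=
    ⟨_, (chartAt E p).map_source hq, (chartAt E p).left_inv hq⟩
  rw [(chartAt E p).right_inv hy]
  have hsymm := mfderiv_chartAt_symm_tangentChart p hy
  exact congrArg₂ (fun a b => g _ a b) (hsymm v) (hsymm w)

theorem metricInChart_self
    (g : ∀ q : M, TangentSpace 𝓘(ℝ, E) q →L[ℝ] TangentSpace 𝓘(ℝ, E) q →L[ℝ] ℝ) (p : M) (v w : E) :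
    metricInChart g p (chartAt E p p) v w = g p v w :=
  (congrArg₂ (fun a b : E => metricInChart g p (chartAt E p p) a b) (tangentChart_self p v)
    (tangentChart_self p w)).symm.trans
      (metricInChart_tangentChart g p (mem_chart_source E p) v w)

theorem fderiv_mapInChart_tangentChart (p : M) {q : M}
    (hq : q ∈ (chartAt E p).source) (hfq : f q ∈ (chartAt F (f p)).source)
    (hf : MDifferentiableAt 𝓘(ℝ, E) 𝓘(ℝ, F) f q) (v : TangentSpace 𝓘(ℝ, E) q) :
    fderiv ℝ (mapInChart (E := E) (F := F) f p) (chartAt E p q) (tangentChart p hq v) =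
      tangentChart (f p) hfq (mfderiv 𝓘(ℝ, E) 𝓘(ℝ, F) f q v) := by
  obtain ⟨y, hy, rfl⟩ : ∃ y ∈ (chartAt E p).target, (chartAt E p).symm y = q :=
    ⟨_, (chartAt E p).map_source hq, (chartAt E p).left_inv hq⟩
  rw [(chartAt E p).right_inv hy]
  have hsymm := ((mdifferentiable_chart (I := 𝓘(ℝ, E)) p).mdifferentiableAt_symm hy).hasMFDerivAt
  have hchart := ((mdifferentiable_chart (I := 𝓘(ℝ, F)) (f p)).mdifferentiableAt hfq).hasMFDerivAt
  have hcomp := HasFDerivAt.fderiv (𝕜 := ℝ) (E := E) (F := F)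
    (f := mapInChart (E := E) (F := F) f p)
    (HasMFDerivAt.comp y hchart (HasMFDerivAt.comp y hf.hasMFDerivAt hsymm)).hasFDerivAt
  refine (congrArg (fun L : E →L[ℝ] F => L (tangentChart p hq v)) hcomp).trans ?_
  exact congrArg (fun a => (mfderiv 𝓘(ℝ, F) 𝓘(ℝ, F) (chartAt F (f p)) (f ((chartAt E p).symm y))
    (mfderiv 𝓘(ℝ, E) 𝓘(ℝ, F) f ((chartAt E p).symm y) a) : F))
      (mfderiv_chartAt_symm_tangentChart p hy v)

theorem fderiv_mapInChart_self (p : M) (hf : MDifferentiableAt 𝓘(ℝ, E) 𝓘(ℝ, F) f p)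
    (v : E) : fderiv ℝ (mapInChart (E := E) (F := F) f p) (chartAt E p p) v =
      (mfderiv 𝓘(ℝ, E) 𝓘(ℝ, F) f p v : F) := by
  have hderiv := fderiv_mapInChart_tangentChart p (mem_chart_source E p)
    (mem_chart_source F (f p)) hf v
  rw [tangentChart_self] at hderiv
  exact (congrArg (fun a : E => fderiv ℝ (mapInChart (E := E) (F := F) f p)
    (chartAt E p p) a) (tangentChart_self p v)).symm.trans hderiv

theorem differentiableAt_vectorField_inChart {X : ∀ q : M, TangentSpace 𝓘(ℝ, E) q} {p : M}
    (hX : ContMDiffAt 𝓘(ℝ, E) 𝓘(ℝ, E).tangent ∞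
      (fun q => (⟨q, X q⟩ : TangentBundle 𝓘(ℝ, E) M)) p) :
    DifferentiableAt ℝ (fun x : E => (mfderiv 𝓘(ℝ, E) 𝓘(ℝ, E) (chartAt E p)
      ((chartAt E p).symm x) (X ((chartAt E p).symm x)) : E)) (chartAt E p p) := by
  let e := trivializationAt E (TangentSpace 𝓘(ℝ, E)) p
  have hsymm : ContMDiffAt 𝓘(ℝ, E) 𝓘(ℝ, E) ∞ (chartAt E p).symm (chartAt E p p) :=
    (contMDiffOn_chart_symm (I := 𝓘(ℝ, E)) (n := ∞) (x := p)).contMDiffAt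
      ((chartAt E p).open_target.mem_nhds (mem_chart_target E p))
  have hcoord : ContMDiffAt 𝓘(ℝ, E) 𝓘(ℝ, E) ∞
      ((fun q => (e ⟨q, X q⟩).2) ∘ (chartAt E p).symm) (chartAt E p p) := by
    refine ContMDiffAt.comp _ ?_ hsymm
    rw [(chartAt E p).left_inv (mem_chart_source E p)]
    exact (Bundle.contMDiffAt_section (IB := 𝓘(ℝ, E)) p).1 hX
  refine (hcoord.contDiffAt.differentiableAt (by simp)).congr_of_eventuallyEq ?_
  filter_upwards [(chartAt E p).open_target.mem_nhds (mem_chart_target E p)] with x hxt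
  have hx := (chartAt E p).map_target hxt
  exact (DFunLike.congr_fun (TangentBundle.continuousLinearMapAt_trivializationAt
    (I := 𝓘(ℝ, E)) hx) _).symm.trans
      (e.continuousLinearMapAt_apply_of_mem (R := ℝ) (by simpa [e] using hx) _)

end Charts

section Ambient

variable {F : Type*} [NormedAddCommGroup F] [NormedSpace ℝ F]
  {N : Type*} [TopologicalSpace N] [ChartedSpace F N]

namespace SemiRiemannianMetric

variable (g : SemiRiemannianMetric F N) (q : N)

theorem contDiffAt_metricInChart : ContDiffAt ℝ ∞ (metricInChart g.form q) (chartAt F q q) :=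
  (g.smooth q).contDiffAt ((chartAt F q).open_target.mem_nhds (mem_chart_target F q))

theorem metricInChart_symm (y v w : F) :
    metricInChart g.form q y v w = metricInChart g.form q y w v :=
  g.symm _ _ _

variable [FiniteDimensional ℝ F]

theorem isInvertible_form : (g.form q : F →L[ℝ] F →L[ℝ] ℝ).IsInvertible :=
  isInvertible_of_nondegenerate (E := F) (g.nondegenerate q)

variable [IsManifold 𝓘(ℝ, F) ∞ N]

theorem isInvertible_metricInChart : (metricInChart g.form q (chartAt F q q)).IsInvertible :=
  isInvertible_of_nondegenerate fun v hv => g.nondegenerate q v fun w =>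
    (metricInChart_self _ _ _ _).symm.trans (hv w)

end SemiRiemannianMetric

end Ambient

section Hypersurface

variable {E : Type*} [NormedAddCommGroup E] [NormedSpace ℝ E]
  {F : Type*} [NormedAddCommGroup F] [NormedSpace ℝ F]
  {M : Type*} [TopologicalSpace M] [ChartedSpace E M] [IsManifold 𝓘(ℝ, E) ∞ M]
  {N : Type*} [TopologicalSpace N] [ChartedSpace F N]
  {g : SemiRiemannianMetric F N} {f : M → N} {S : ScreenDistribution (E := E) g f} {p q : M}
  {ξ : TangentSpace 𝓘(ℝ, E) q} {n : TangentSpace 𝓘(ℝ, F) (f q)}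

namespace ScreenDistribution

theorem isNormalizingPair_iff : S.IsNormalizingPair q ξ n ↔
    IsNullTransversalPair (g.form (f q)) (mfderiv 𝓘(ℝ, E) 𝓘(ℝ, F) f q) (S.space q) ξ n :=
  ⟨fun h => ⟨mem_radical_iff.1 h.mem_radical, h.null, h.orthogonal, h.normalized⟩,
    fun h => ⟨mem_radical_iff.2 h.form_radical, h.null, h.orthogonal, h.normalized⟩⟩

section

variable [FiniteDimensional ℝ E] [FiniteDimensional ℝ F]
  (hf : IsLightlikeHypersurface (E := E) g f)
include hf

theorem exists_isNormalizingPair (S : ScreenDistribution (E := E) g f) (q : M) :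
    ∃ ξ n, S.IsNormalizingPair q ξ n := by
  simp only [isNormalizingPair_iff]
  exact exists_isNullTransversalPair (E := E) (F := F) (g.symm _) (g.isInvertible_form _)
    (hf.immersive q) hf.codimension_one (hf.finrank_radical q) (S.isCompl q).disjoint

theorem IsNormalizingPair.isInvertible_splitting (h : S.IsNormalizingPair q ξ n) :
    (splitting (E := E) (F := F) (mfderiv 𝓘(ℝ, E) 𝓘(ℝ, F) f q) n).IsInvertible :=
  LightlikeGeometry.isInvertible_splitting (E := E) (F := F) (hf.immersive q)
    ((isNormalizingPair_iff.1 h).map_ne (g.symm _)) hf.codimension_one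

theorem IsNormalizingPair.exists_smul_eq {ξ' : TangentSpace 𝓘(ℝ, E) q}
    {n' : TangentSpace 𝓘(ℝ, F) (f q)} (h : S.IsNormalizingPair q ξ n)
    (h' : S.IsNormalizingPair q ξ' n') : ∃ a : ℝ, a • n = n' :=
  (isNormalizingPair_iff.1 h).exists_smul_eq (g.symm _) (hf.finrank_radical q) (S.isCompl q)
    (fun v => ⟨_, _, map_tangentialPart_add (E := E) (F := F) (h.isInvertible_splitting hf) v⟩)
    (isNormalizingPair_iff.1 h')

theorem IsNormalizingPair.ltr_le_ker (h : S.IsNormalizingPair q ξ n) :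
    S.ltr q ≤ LinearMap.ker
      (tangentialPart (E := E) (F := F) (mfderiv 𝓘(ℝ, E) 𝓘(ℝ, F) f q) n : F →ₗ[ℝ] E) := by
  refine Submodule.span_le.2 ?_
  rintro _ ⟨ξ', h'⟩
  obtain ⟨a, rfl⟩ := h.exists_smul_eq hf h'
  have hself := tangentialPart_self (E := E) (F := F) (h.isInvertible_splitting hf)
  exact (map_smul _ a n).trans ((congrArg (fun z : E => a • z) hself).trans (smul_zero a))

theorem IsNormalizingPair.tangentialProjection_eq (h : S.IsNormalizingPair q ξ n) :
    (S.tangentialProjection q : F →L[ℝ] E) =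
      tangentialPart (E := E) (F := F) (mfderiv 𝓘(ℝ, E) 𝓘(ℝ, F) f q) n := by
  have hi := h.isInvertible_splitting hf
  obtain ⟨hmap, hltr⟩ := Classical.epsilon_spec
    (p := fun τ : TangentSpace 𝓘(ℝ, F) (f q) →L[ℝ] TangentSpace 𝓘(ℝ, E) q =>
      (∀ v, τ (mfderiv 𝓘(ℝ, E) 𝓘(ℝ, F) f q v) = v) ∧ ∀ n ∈ S.ltr q, τ n = 0)
    ⟨tangentialPart (E := E) (F := F) (mfderiv 𝓘(ℝ, E) 𝓘(ℝ, F) f q) n,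
      tangentialPart_map (E := E) (F := F) hi, fun m hm => h.ltr_le_ker hf hm⟩
  exact eq_tangentialPart hi hmap (hltr n (Submodule.subset_span ⟨ξ, h⟩))

end

variable [IsManifold 𝓘(ℝ, F) ∞ N] (hq : q ∈ (chartAt E p).source)
  (hfq : f q ∈ (chartAt F (f p)).source)

theorem tangentialProjectionInChart_apply (S : ScreenDistribution (E := E) g f)
    (v : TangentSpace 𝓘(ℝ, F) (f q)) :
    S.tangentialProjectionInChart p (chartAt E p q) (tangentChart (f p) hfq v) =
      tangentChart p hq (S.tangentialProjection q v) := by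
  obtain ⟨y, hy, rfl⟩ : ∃ y ∈ (chartAt E p).target, (chartAt E p).symm y = q :=
    ⟨_, (chartAt E p).map_source hq, (chartAt E p).left_inv hq⟩
  rw [(chartAt E p).right_inv hy, tangentialProjectionInChart]
  have hinv : (mfderiv 𝓘(ℝ, F) 𝓘(ℝ, F) (chartAt F (f p)) (f ((chartAt E p).symm y)) :
      TangentSpace 𝓘(ℝ, F) (f ((chartAt E p).symm y)) →L[ℝ] F).inverse
        (tangentChart (f p) hfq v) = v :=
    (DFunLike.congr_fun (ContinuousLinearMap.inverse_equiv (tangentChart (f p) hfq)) _).trans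
      ((tangentChart (f p) hfq).symm_apply_apply v)
  exact congrArg (fun a => (mfderiv 𝓘(ℝ, E) 𝓘(ℝ, E) (chartAt E p) ((chartAt E p).symm y)
    (S.tangentialProjection ((chartAt E p).symm y) a) : E)) hinv

variable (hf : IsLightlikeHypersurface (E := E) g f)
include hf

theorem isNullTransversalPair_inChart_iff :
    IsNullTransversalPair (metricInChart g.form (f p) (mapInChart f p (chartAt E p q)))
        (fderiv ℝ (mapInChart f p) (chartAt E p q))
        ((S.space q).map (tangentChart p hq).toLinearEquiv.toLinearMap) (tangentChart p hq ξ)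
        (tangentChart (f p) hfq n) ↔
      S.IsNormalizingPair q ξ n := by
  rw [isNormalizingPair_iff, mapInChart_chartAt hq]
  exact isNullTransversalPair_map_iff (metricInChart_tangentChart g.form (f p) hfq)
    (fderiv_mapInChart_tangentChart p hq hfq (hf.smooth.mdifferentiable (by simp) q))

include hq in
theorem tangentialProjectionInChart_eq [FiniteDimensional ℝ E] [FiniteDimensional ℝ F]
    (h : S.IsNormalizingPair q ξ n)
    (hi : (splitting (fderiv ℝ (mapInChart (E := E) (F := F) f p) (chartAt E p q))
      (tangentChart (f p) hfq n)).IsInvertible) :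
    S.tangentialProjectionInChart p (chartAt E p q) =
      tangentialPart (fderiv ℝ (mapInChart f p) (chartAt E p q)) (tangentChart (f p) hfq n) := by
  have hi' := h.isInvertible_splitting hf
  refine eq_tangentialPart hi (fun v => ?_) ?_
  · obtain ⟨v, rfl⟩ := (tangentChart p hq).surjective v
    rw [fderiv_mapInChart_tangentChart p hq hfq (hf.smooth.mdifferentiable (by simp) q),
      tangentialProjectionInChart_apply hq hfq]
    refine congrArg (tangentChart p hq) ?_
    exact (DFunLike.congr_fun (h.tangentialProjection_eq hf) _).trans
      (tangentialPart_map (E := E) (F := F) hi' v)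
  · rw [tangentialProjectionInChart_apply hq hfq]
    refine (congrArg (tangentChart p hq) ?_).trans (map_zero (tangentChart p hq))
    exact (DFunLike.congr_fun (h.tangentialProjection_eq hf) n).trans
      (tangentialPart_self (E := E) (F := F) hi')

end ScreenDistribution

end Hypersurface

/-! ### Differentiable normalizing pairs -/

section Frames

variable {E : Type*} [NormedAddCommGroup E] [NormedSpace ℝ E]
  {M : Type*} [TopologicalSpace M] [ChartedSpace E M] [IsManifold 𝓘(ℝ, E) ∞ M]
  {k : ℕ} {X : Fin k → ∀ q : M, TangentSpace 𝓘(ℝ, E) q} {p q : M}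

/-- The linear map `ℝᵏ → E` whose columns are the values at the point with coordinates `x` of the
vector fields `X` in the preferred chart at `p`. -/
def frameInChart (X : Fin k → ∀ q : M, TangentSpace 𝓘(ℝ, E) q) (p : M) (x : E) :
    (Fin k → ℝ) →L[ℝ] E :=
  (ContinuousLinearEquiv.piRing (𝕜 := ℝ) (E := E) (Fin k)).symm fun i =>
    (mfderiv 𝓘(ℝ, E) 𝓘(ℝ, E) (chartAt E p) ((chartAt E p).symm x) (X i ((chartAt E p).symm x)) : E)

theorem differentiableAt_frameInChart (hX : ∀ i, ContMDiffAt 𝓘(ℝ, E) 𝓘(ℝ, E).tangent ∞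
    (fun q => (⟨q, X i q⟩ : TangentBundle 𝓘(ℝ, E) M)) p) :
    DifferentiableAt ℝ (frameInChart X p) (chartAt E p p) :=
  (ContinuousLinearEquiv.piRing (𝕜 := ℝ) (E := E) (Fin k)).symm.differentiableAt.comp _
    (differentiableAt_pi.2 fun i => differentiableAt_vectorField_inChart (hX i))

theorem coe_frameInChart (hq : q ∈ (chartAt E p).source) :
    (frameInChart X p (chartAt E p q) : (Fin k → ℝ) →ₗ[ℝ] E) =
      (tangentChart p hq).toLinearEquiv.toLinearMap ∘ₗ
        Fintype.linearCombination ℝ fun i => X i q := by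
  obtain ⟨y, hy, rfl⟩ : ∃ y ∈ (chartAt E p).target, (chartAt E p).symm y = q :=
    ⟨_, (chartAt E p).map_source hq, (chartAt E p).left_inv hq⟩
  rw [(chartAt E p).right_inv hy]
  refine LinearMap.ext fun c => ?_
  refine (LinearEquiv.piRing_symm_apply (R := ℝ) (M := E) (S := ℝ) _ c).trans ?_
  rw [LinearMap.comp_apply, Fintype.linearCombination_apply, map_sum]
  simp only [map_smul]
  rfl

theorem range_frameInChart (hq : q ∈ (chartAt E p).source) :
    LinearMap.range (frameInChart X p (chartAt E p q) : (Fin k → ℝ) →ₗ[ℝ] E) =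
      (Submodule.span ℝ (Set.range fun i => X i q)).map
        (tangentChart p hq).toLinearEquiv.toLinearMap := by
  rw [coe_frameInChart hq, LinearMap.range_comp, Fintype.range_linearCombination]

theorem injective_frameInChart (hq : q ∈ (chartAt E p).source)
    (hX : LinearIndependent ℝ fun i => X i q) :
    Function.Injective (frameInChart X p (chartAt E p q)) := by
  have hcoe := congrArg DFunLike.coe (coe_frameInChart (X := X) hq)
  rw [ContinuousLinearMap.coe_coe] at hcoe
  rw [hcoe]
  exact (tangentChart p hq).injective.comp hX.fintypeLinearCombination_injective

end Frames

open ScreenDistribution (mapInChart)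

section Transversals

variable {E : Type*} [NormedAddCommGroup E] [NormedSpace ℝ E] [FiniteDimensional ℝ E]
  {F : Type*} [NormedAddCommGroup F] [NormedSpace ℝ F] [FiniteDimensional ℝ F]
  {M : Type*} [TopologicalSpace M] [ChartedSpace E M] [IsManifold 𝓘(ℝ, E) ∞ M]
  {N : Type*} [TopologicalSpace N] [ChartedSpace F N]
  {g : SemiRiemannianMetric F N} {f : M → N}

namespace IsLightlikeHypersurface

variable (hf : IsLightlikeHypersurface (E := E) g f) (p : M)
include hf

omit [FiniteDimensional ℝ E] [FiniteDimensional ℝ F] [IsManifold 𝓘(ℝ, E) ∞ M] in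
theorem contDiffAt_fderiv_mapInChart :
    ContDiffAt ℝ ∞ (fderiv ℝ (mapInChart (E := E) (F := F) f p)) (chartAt E p p) :=
  (contDiffAt_mapInChart hf.smooth p).fderiv_right (by simp)

omit [FiniteDimensional ℝ E] [FiniteDimensional ℝ F] [IsManifold 𝓘(ℝ, E) ∞ M] in
theorem contDiffAt_metricInChart_mapInChart :
    ContDiffAt ℝ ∞ (fun x => metricInChart g.form (f p) (mapInChart f p x)) (chartAt E p p) := by
  refine ContDiffAt.comp (𝕜 := ℝ) (chartAt E p p) (g := metricInChart g.form (f p)) ?_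
    (contDiffAt_mapInChart hf.smooth p)
  rw [mapInChart_chartAt (mem_chart_source E p)]
  exact g.contDiffAt_metricInChart (f p)

variable [IsManifold 𝓘(ℝ, F) ∞ N]

omit [FiniteDimensional ℝ E] [FiniteDimensional ℝ F] in
theorem injective_fderiv_mapInChart :
    Function.Injective (fderiv ℝ (mapInChart (E := E) (F := F) f p) (chartAt E p p)) := by
  intro v w h
  refine hf.immersive p ?_
  rwa [fderiv_mapInChart_self p (hf.smooth.mdifferentiable (by simp) p),
    fderiv_mapInChart_self p (hf.smooth.mdifferentiable (by simp) p)] at h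

end IsLightlikeHypersurface

namespace ScreenDistribution

omit [FiniteDimensional ℝ F] in
theorem finrank_eq_add_one (hf : IsLightlikeHypersurface (E := E) g f)
    (S : ScreenDistribution (E := E) g f) (p : M) :
    finrank ℝ E = finrank ℝ (S.space p) + 1 := by
  have : FiniteDimensional ℝ (TangentSpace 𝓘(ℝ, E) p) := inferInstanceAs (FiniteDimensional ℝ E)
  have hsum := Submodule.finrank_add_eq_of_isCompl (S.isCompl p)
  have hrad := hf.finrank_radical p
  exact hsum.symm.trans ((congrArg (· + _) hrad).trans (add_comm _ _))

variable [IsManifold 𝓘(ℝ, F) ∞ N]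

theorem exists_differentiableAt_isNormalizingPair (hf : IsLightlikeHypersurface (E := E) g f)
    (S : ScreenDistribution (E := E) g f) (p : M) :
    ∃ n : E → F, DifferentiableAt ℝ n (chartAt E p p) ∧ ∀ᶠ q in 𝓝 p,
      q ∈ (chartAt E p).source ∧ ∃ hfq : f q ∈ (chartAt F (f p)).source,
        ∃ ξ m, S.IsNormalizingPair q ξ m ∧ tangentChart (f p) hfq m = n (chartAt E p q) := by
  obtain ⟨U, hU, hpU, k, X, hX, hspan⟩ := S.smooth p
  have hk : finrank ℝ E = finrank ℝ (Fin k → ℝ) + 1 := by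
    rw [S.finrank_eq_add_one hf p, (hspan p hpU).2, Module.finrank_fin_fun]
    exact congrArg (· + 1) ((finrank_span_eq_card (hspan p hpU).1).trans (Fintype.card_fin k))
  have hp : p ∈ (chartAt E p).source := mem_chart_source E p
  have hnear : ∀ᶠ q in 𝓝 p,
      (q ∈ (chartAt E p).source ∧ f q ∈ (chartAt F (f p)).source) ∧ q ∈ U :=
    (((chartAt E p).open_source.eventually_mem hp).and
      (hf.smooth.continuous.continuousAt.eventually_mem
        ((chartAt F (f p)).open_source.mem_nhds (mem_chart_source F (f p))))).and
      (hU.eventually_mem hpU)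
  have hpair : ∀ᶠ x in 𝓝 (chartAt E p p), ∃ ξ n,
      IsNullTransversalPair (metricInChart g.form (f p) (mapInChart f p x))
        (fderiv ℝ (mapInChart f p) x)
        (LinearMap.range (frameInChart X p x : (Fin k → ℝ) →ₗ[ℝ] E)) ξ n := by
    refine eventually_nhds_chartAt_iff.2 (hnear.mono ?_)
    rintro q ⟨⟨hq, hfq⟩, hqU⟩
    obtain ⟨ξ, n, h⟩ := exists_isNormalizingPair hf S q
    rw [range_frameInChart hq, ← (hspan q hqU).2]
    exact ⟨_, _, (isNullTransversalPair_inChart_iff hq hfq hf).2 h⟩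
  obtain ⟨n, hn, hpn⟩ := exists_differentiableAt_isNullTransversalPair
    (hf.contDiffAt_metricInChart_mapInChart p |>.differentiableAt (by simp))
    (hf.contDiffAt_fderiv_mapInChart p |>.differentiableAt (by simp))
    (differentiableAt_frameInChart fun i => (hX i).contMDiffAt (hU.mem_nhds hpU))
    (by rw [mapInChart_chartAt hp]; exact g.isInvertible_metricInChart (f p))
    (hf.injective_fderiv_mapInChart p) (injective_frameInChart hp (hspan p hpU).1)
    hf.codimension_one hk (.of_forall fun x => g.metricInChart_symm _ _) hpair
  refine ⟨n, hn, ?_⟩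
  filter_upwards [hnear, eventually_nhds_chartAt_iff.1 hpn] with q ⟨⟨hq, hfq⟩, hqU⟩ ⟨ξ, hξ⟩
  rw [range_frameInChart hq, ← (hspan q hqU).2] at hξ
  refine ⟨hq, hfq, (tangentChart p hq).symm ξ, (tangentChart (f p) hfq).symm (n (chartAt E p q)),
    (isNullTransversalPair_inChart_iff hq hfq hf).1 ?_,
    ContinuousLinearEquiv.apply_symm_apply _ _⟩
  simpa only [ContinuousLinearEquiv.apply_symm_apply] using hξ

theorem exists_differentiableAt_tangentialProjectionInChart_eq
    (hf : IsLightlikeHypersurface (E := E) g f) (S : ScreenDistribution (E := E) g f) (p : M) :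
    ∃ n : E → F, DifferentiableAt ℝ n (chartAt E p p) ∧
      (∃ ξ, S.IsNormalizingPair p ξ (n (chartAt E p p))) ∧
      ∀ᶠ x in 𝓝 (chartAt E p p),
        metricInChart g.form (f p) (mapInChart f p x) (n x) (n x) = 0 ∧
        (splitting (fderiv ℝ (mapInChart f p) x) (n x)).IsInvertible ∧
        S.tangentialProjectionInChart p x =
          tangentialPart (fderiv ℝ (mapInChart f p) x) (n x) := by
  obtain ⟨n, hn, hpair⟩ := exists_differentiableAt_isNormalizingPair hf S p
  obtain ⟨hp, hfp, ξ, m, h, hm⟩ := hpair.self_of_nhds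
  have hi : (splitting (fderiv ℝ (mapInChart f p) (chartAt E p p))
      (n (chartAt E p p))).IsInvertible :=
    hm ▸ isInvertible_splitting (hf.injective_fderiv_mapInChart p)
      (((isNullTransversalPair_inChart_iff hp hfp hf).2 h).map_ne (g.metricInChart_symm _ _))
      hf.codimension_one
  refine ⟨n, hn, ⟨ξ, hm ▸ (tangentChart_self (f p) m).symm ▸ h⟩, ?_⟩
  have hΦ := (hf.contDiffAt_fderiv_mapInChart p).differentiableAt (by simp)
  have hiq := eventually_isInvertible_splitting hΦ hn hi
  rw [eventually_nhds_chartAt_iff] at hiq ⊢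
  filter_upwards [hiq, hpair] with q hi ⟨hq, hfq, ξ, m, h, hm⟩
  rw [← hm] at hi ⊢
  exact ⟨((isNullTransversalPair_inChart_iff hq hfq hf).2 h).null, hi,
    tangentialProjectionInChart_eq hq hfq hf h hi⟩

end ScreenDistribution

end Transversals

/-! ### The induced connection -/

section Ambient

variable {F : Type*} [NormedAddCommGroup F] [NormedSpace ℝ F] [FiniteDimensional ℝ F]
  {N : Type*} [TopologicalSpace N] [ChartedSpace F N] [IsManifold 𝓘(ℝ, F) ∞ N]

namespace SemiRiemannianMetric

variable (g : SemiRiemannianMetric F N) (q : N)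

theorem isCompatibleAt_christoffel_metricInChart :
    IsCompatibleAt (christoffel (metricInChart g.form q)) (metricInChart g.form q)
      (chartAt F q q) :=
  isCompatibleAt_christoffel ((g.contDiffAt_metricInChart q).differentiableAt (by simp))
    (.of_forall fun y => g.metricInChart_symm q y) (g.isInvertible_metricInChart q)

theorem differentiableAt_christoffel_metricInChart :
    DifferentiableAt ℝ (christoffel (metricInChart g.form q)) (chartAt F q q) :=
  have : CompleteSpace F := FiniteDimensional.complete ℝ F
  differentiableAt_christoffel ((g.contDiffAt_metricInChart q).of_le ENat.LEInfty.out)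
    (g.isInvertible_metricInChart q)

theorem isAlgebraicCurvature_riemann :
    IsAlgebraicCurvature fun x y z w => g.form q (g.riemann q x y z) w := by
  have : CompleteSpace F := FiniteDimensional.complete ℝ F
  have hR := IsAlgebraicCurvature.of_form_curvature
    ((g.contDiffAt_metricInChart q).of_le ENat.LEInfty.out)
    (.of_forall fun y => g.metricInChart_symm q y) (g.isInvertible_metricInChart q)
  rwa [show metricInChart g.form q (chartAt F q q) = (g.form q : F →L[ℝ] F →L[ℝ] ℝ) from
    ContinuousLinearMap.ext fun v => ContinuousLinearMap.ext (metricInChart_self g.form q v)] at hR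

theorem form_riemann_eq {c : ℝ}
    (hne : ∃ v w, g.form q v v * g.form q w w - g.form q v w ^ 2 ≠ 0)
    (hc : ∀ v w, g.form q v v * g.form q w w - g.form q v w ^ 2 ≠ 0 →
      g.sectionalCurvature q v w = c) (x y z w : TangentSpace 𝓘(ℝ, F) q) :
    g.form q (g.riemann q x y z) w =
      c * (g.form q y z * g.form q x w - g.form q x z * g.form q y w) :=
  form_curvature_eq_of_constant_sectional (F := F) (g.symm q) (g.isAlgebraicCurvature_riemann q)
    hne hc x y z w

end SemiRiemannianMetric

end Ambient

section InducedConnection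

variable {E : Type*} [NormedAddCommGroup E] [NormedSpace ℝ E] [FiniteDimensional ℝ E]
  {F : Type*} [NormedAddCommGroup F] [NormedSpace ℝ F] [FiniteDimensional ℝ F]

omit [FiniteDimensional ℝ E] [FiniteDimensional ℝ F] in
set_option maxSynthPendingDepth 4 in
theorem differentiableAt_bilinearComp {P : Type*} [NormedAddCommGroup P] [NormedSpace ℝ P]
    {B : P → F →L[ℝ] F →L[ℝ] F} {A : P → E →L[ℝ] F} {x : P}
    (hB : DifferentiableAt ℝ B x) (hA : DifferentiableAt ℝ A x) :
    DifferentiableAt ℝ (fun x => (B x).bilinearComp (A x) (A x)) x := by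
  have hflip : DifferentiableAt ℝ (fun x => (B x ∘L A x).flip) x :=
    (ContinuousLinearMap.flipₗᵢ ℝ E F F).toContinuousLinearEquiv.differentiableAt.comp x
      (hB.clm_comp hA)
  exact (ContinuousLinearMap.flipₗᵢ ℝ E E F).toContinuousLinearEquiv.differentiableAt.comp x
    (hflip.clm_comp hA)

variable {M : Type*} [TopologicalSpace M] [ChartedSpace E M] [IsManifold 𝓘(ℝ, E) ∞ M]
  {N : Type*} [TopologicalSpace N] [ChartedSpace F N]
  {g : SemiRiemannianMetric F N} {f : M → N} {S : ScreenDistribution (E := E) g f} {p : M}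

namespace ScreenDistribution

omit [FiniteDimensional ℝ E] [FiniteDimensional ℝ F] in
theorem isInducedAt_inducedChristoffel {n : E → F} {x : E}
    (hΦ : DifferentiableAt ℝ (fderiv ℝ (mapInChart (E := E) (F := F) f p)) x)
    (hi : (splitting (fderiv ℝ (mapInChart f p) x) (n x)).IsInvertible)
    (hτ : S.tangentialProjectionInChart p x = tangentialPart (fderiv ℝ (mapInChart f p) x) (n x)) :
    IsInducedAt (pullbackConnection (christoffel (metricInChart g.form (f p))) (mapInChart f p))
      (fderiv ℝ (mapInChart f p)) n (S.inducedChristoffel p) x := fun v z => by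
  have hS : S.inducedChristoffel p x v z = tangentialPart (fderiv ℝ (mapInChart f p) x) (n x)
      (covDeriv (pullbackConnection (christoffel (metricInChart g.form (f p))) (mapInChart f p))
        (fun y => fderiv ℝ (mapInChart f p) y z) x v) := by
    rw [covDeriv, fderiv_clm_apply_const hΦ, ← hτ]
    rfl
  exact ⟨_, hS ▸ (map_tangentialPart_add hi _).symm⟩

section Smoothness

variable [IsManifold 𝓘(ℝ, F) ∞ N] (hf : IsLightlikeHypersurface (E := E) g f)
include hf

theorem differentiableAt_inducedChristoffel (S : ScreenDistribution (E := E) g f) (p : M) :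
    DifferentiableAt ℝ (S.inducedChristoffel p) (chartAt E p p) := by
  obtain ⟨n, hn, -, hpair⟩ := exists_differentiableAt_tangentialProjectionInChart_eq hf S p
  have hΦ := hf.contDiffAt_fderiv_mapInChart p
  have hτ : DifferentiableAt ℝ (S.tangentialProjectionInChart p) (chartAt E p p) :=
    (differentiableAt_tangentialPart (hΦ.differentiableAt (by simp)) hn
      hpair.self_of_nhds.2.1).congr_of_eventuallyEq (hpair.mono fun x hx => hx.2.2)
  have hΓ : DifferentiableAt ℝ (fun x => christoffel (metricInChart g.form (f p))
      (mapInChart f p x)) (chartAt E p p) := by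
    refine DifferentiableAt.fun_comp' (chartAt E p p)
      (g := christoffel (metricInChart g.form (f p))) ?_
      ((contDiffAt_mapInChart hf.smooth p).differentiableAt (by simp))
    rw [mapInChart_chartAt (mem_chart_source E p)]
    exact g.differentiableAt_christoffel_metricInChart (f p)
  exact ((ContinuousLinearMap.compL ℝ E F E).differentiableAt.comp _ hτ).clm_comp
    ((differentiableAt_fderiv (hΦ.of_le ENat.LEInfty.out)).add
      (differentiableAt_bilinearComp hΓ (hΦ.differentiableAt (by simp))))

theorem exists_form_inducedCurvature (S : ScreenDistribution (E := E) g f) (p : M) :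
    ∃ ξ n, S.IsNormalizingPair p ξ n ∧ ∀ v w z,
      g.form (f p) n (mfderiv 𝓘(ℝ, E) 𝓘(ℝ, F) f p (S.inducedCurvature p v w z)) =
        g.form (f p) n (g.riemann (f p) (mfderiv 𝓘(ℝ, E) 𝓘(ℝ, F) f p v)
          (mfderiv 𝓘(ℝ, E) 𝓘(ℝ, F) f p w) (mfderiv 𝓘(ℝ, E) 𝓘(ℝ, F) f p z)) := by
  obtain ⟨n, hn, ⟨ξ, hξ⟩, hpair⟩ := exists_differentiableAt_tangentialProjectionInChart_eq hf S p
  refine ⟨ξ, _, hξ, fun (v w z : E) => ?_⟩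
  have hφ := contDiffAt_mapInChart hf.smooth p
  have hφ₂ : ContDiffAt ℝ 2 (mapInChart f p) (chartAt E p p) := hφ.of_le ENat.LEInfty.out
  have hΦ := hf.contDiffAt_fderiv_mapInChart p
  have hφp : mapInChart f p (chartAt E p p) = chartAt F (f p) (f p) :=
    mapInChart_chartAt (mem_chart_source E p)
  have hG := (g.contDiffAt_metricInChart (f p)).differentiableAt (by simp)
  have hΓ := g.differentiableAt_christoffel_metricInChart (f p)
  have hΓG := g.isCompatibleAt_christoffel_metricInChart (f p)
  rw [← hφp] at hG hΓ hΓG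
  have hfderiv := fderiv_mapInChart_self p (hf.smooth.mdifferentiable (by simp) p)
  have hgauss := gauss_equation (hΓG.pullback hG (hφ.differentiableAt (by simp)))
    ((hf.contDiffAt_metricInChart_mapInChart p).differentiableAt (by simp))
    (g.metricInChart_symm _ _) hn (hpair.mono fun x hx => hx.1)
    (differentiableAt_pullbackConnection hΓ hφ₂) (differentiableAt_inducedChristoffel hf S p)
    (hΦ.of_le ENat.LEInfty.out)
    ((eventually_differentiableAt (hΦ.of_le (by simp))).mp (hpair.mono fun x hx hd =>
      isInducedAt_inducedChristoffel hd hx.2.1 hx.2.2)) v w z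
  rw [bundleCurvature_pullbackConnection hΓ hφ₂, hφp, metricInChart_self, metricInChart_self,
    hfderiv, hfderiv, hfderiv, hfderiv] at hgauss
  exact hgauss.symm

variable {ξ : TangentSpace 𝓘(ℝ, E) p} {n : TangentSpace 𝓘(ℝ, F) (f p)}

theorem IsNormalizingPair.form_inducedCurvature (h : S.IsNormalizingPair p ξ n)
    (v w z : TangentSpace 𝓘(ℝ, E) p) :
    g.form (f p) n (mfderiv 𝓘(ℝ, E) 𝓘(ℝ, F) f p (S.inducedCurvature p v w z)) =
      g.form (f p) n (g.riemann (f p) (mfderiv 𝓘(ℝ, E) 𝓘(ℝ, F) f p v)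
        (mfderiv 𝓘(ℝ, E) 𝓘(ℝ, F) f p w) (mfderiv 𝓘(ℝ, E) 𝓘(ℝ, F) f p z)) := by
  obtain ⟨ξ', n', h', hgauss⟩ := exists_form_inducedCurvature hf S p
  obtain ⟨a, rfl⟩ := h'.exists_smul_eq hf h
  simp only [map_smul, smul_apply, hgauss]

end Smoothness

end ScreenDistribution

end InducedConnection

/-! ### Einstein hypersurfaces -/

section Einstein

variable {E : Type*} [NormedAddCommGroup E] [NormedSpace ℝ E]
  {F : Type*} [NormedAddCommGroup F] [NormedSpace ℝ F]

theorem curvature_eq_zero_of_finrank_eq_one (hE : finrank ℝ E = 1) (Γ : E → E →L[ℝ] E →L[ℝ] E)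
    (x : E) : curvature Γ x = 0 := by
  ext v w z
  rcases eq_or_ne v 0 with rfl | hv
  · simp
  · obtain ⟨a, rfl⟩ := (finrank_eq_one_iff_of_nonzero' v hv).1 hE w
    simp [curvature_apply]

variable {M : Type*} [TopologicalSpace M] [ChartedSpace E M] [IsManifold 𝓘(ℝ, E) ∞ M]
  {N : Type*} [TopologicalSpace N] [ChartedSpace F N]
  {g : SemiRiemannianMetric F N} {f : M → N} {p : M}

omit [IsManifold 𝓘(ℝ, E) ∞ M] in
theorem inducedMetric_eq_zero_of_pseudoSphere_eq_empty
    (h₁ : pseudoSphere (E := E) g f p 1 = ∅) (h₂ : pseudoSphere (E := E) g f p (-1) = ∅) :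
    inducedMetric (E := E) g f p = 0 := by
  have hzero := bilinForm_eq_zero_of_ne_one_of_ne_neg_one
    (B := (inducedMetric (E := E) g f p).toBilinForm) ⟨fun v w => g.symm (f p) _ _⟩
    (Set.eq_empty_iff_forall_notMem.1 h₁) (Set.eq_empty_iff_forall_notMem.1 h₂)
  ext v w
  exact LinearMap.congr_fun₂ hzero v w

theorem isEinsteinAt_of_inducedMetric_eq_zero (hf : IsLightlikeHypersurface (E := E) g f)
    (h₀ : inducedMetric (E := E) g f p = 0) (S : ScreenDistribution (E := E) g f) :
    S.IsEinsteinAt p := by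
  have hE : finrank ℝ E = 1 := by
    have htop : radical (inducedMetric (E := E) g f p) = ⊤ :=
      eq_top_iff.2 fun v _ => mem_radical_iff.2 fun w => by rw [h₀]; rfl
    rw [← finrank_top ℝ E, ← hf.finrank_radical p, htop]
    rfl
  have hR : S.inducedCurvature p = 0 := curvature_eq_zero_of_finrank_eq_one hE _ _
  refine ⟨0, fun x y => ?_⟩
  rw [ScreenDistribution.ricci, hR, zero_mul]
  exact map_zero _

namespace ScreenDistribution

section Smooth

variable [FiniteDimensional ℝ E] [FiniteDimensional ℝ F] [IsManifold 𝓘(ℝ, F) ∞ N]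
  {S : ScreenDistribution (E := E) g f} {ξ : TangentSpace 𝓘(ℝ, E) p}
  {n : TangentSpace 𝓘(ℝ, F) (f p)} {c : ℝ}

theorem IsNormalizingPair.form_inducedCurvature_radical
    (hf : IsLightlikeHypersurface (E := E) g f) (h : S.IsNormalizingPair p ξ n)
    (hc : ∀ v w, g.form (f p) v v * g.form (f p) w w - g.form (f p) v w ^ 2 ≠ 0 →
      g.sectionalCurvature (f p) v w = c) (x y : TangentSpace 𝓘(ℝ, E) p) :
    g.form (f p) n (mfderiv 𝓘(ℝ, E) 𝓘(ℝ, F) f p (S.inducedCurvature p x ξ y)) =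
      -c * inducedMetric (E := E) g f p x y := by
  have hξ : ∀ w, g.form (f p) (mfderiv 𝓘(ℝ, E) 𝓘(ℝ, F) f p ξ)
      (mfderiv 𝓘(ℝ, E) 𝓘(ℝ, F) f p w) = 0 := mem_radical_iff.1 h.mem_radical
  have hne : g.form (f p) n n * g.form (f p) (mfderiv 𝓘(ℝ, E) 𝓘(ℝ, F) f p ξ)
      (mfderiv 𝓘(ℝ, E) 𝓘(ℝ, F) f p ξ) -
      g.form (f p) n (mfderiv 𝓘(ℝ, E) 𝓘(ℝ, F) f p ξ) ^ 2 ≠ 0 := by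
    rw [h.null, h.normalized]
    norm_num
  rw [h.form_inducedCurvature hf, g.symm, g.form_riemann_eq (f p) ⟨_, _, hne⟩ hc, hξ,
    g.symm (f p) (mfderiv 𝓘(ℝ, E) 𝓘(ℝ, F) f p ξ) n, h.normalized, zero_mul, zero_sub, mul_one,
    mul_neg, neg_mul]
  rfl

theorem isEinsteinAt_of_constant_trace (hf : IsLightlikeHypersurface (E := E) g f)
    (hR : IsAlgebraicCurvature (S.inducedCurvature₄ p))
    (hc : ∀ v w, g.form (f p) v v * g.form (f p) w w - g.form (f p) v w ^ 2 ≠ 0 →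
      g.sectionalCurvature (f p) v w = c) (h : S.IsNormalizingPair p ξ n) {ε l : ℝ} (hε : ε ≠ 0)
    (hne : (pseudoSphere (E := E) g f p ε).Nonempty)
    (hJ : ∀ x ∈ pseudoSphere (E := E) g f p ε, LinearMap.trace ℝ E (S.pseudoJacobi p n x) = l) :
    S.IsEinsteinAt p := by
  let b : E →L[ℝ] E →L[ℝ] ℝ := inducedMetric (E := E) g f p
  have hb : ∀ x y, b x y = b y x := fun x y => g.symm (f p) _ _
  let η : E →L[ℝ] ℝ := g.form (f p) n ∘L mfderiv 𝓘(ℝ, E) 𝓘(ℝ, F) f p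
  exact ⟨_, trace_ricci_eq_mul_of_constant_on_sphere (E := E) (b := b) (η := η)
    (isInvertible_add_smulRight hb h.mem_radical h.normalized (hf.finrank_radical p)) hb
    h.mem_radical h.normalized hR (h.form_inducedCurvature_radical hf hc) hε hne hJ⟩

end Smooth

end ScreenDistribution

end Einstein

end LightlikeGeometry

end

theorem corollary4p4_general
    {E : Type*} [NormedAddCommGroup E] [NormedSpace ℝ E] [FiniteDimensional ℝ E]
    {F : Type*} [NormedAddCommGroup F] [NormedSpace ℝ F] [FiniteDimensional ℝ F]
    {M : Type*} [TopologicalSpace M] [ChartedSpace E M] [IsManifold 𝓘(ℝ, E) ∞ M]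
    {N : Type*} [TopologicalSpace N] [ChartedSpace F N] [IsManifold 𝓘(ℝ, F) ∞ N]
    {g : LightlikeGeometry.SemiRiemannianMetric F N} {c : ℝ}
    {f : M → N} (hf : LightlikeGeometry.IsLightlikeHypersurface (E := E) g f)
    {u : M} (hc : ∀ v w, g.form (f u) v v * g.form (f u) w w - g.form (f u) v w ^ 2 ≠ 0 →
      g.sectionalCurvature (f u) v w = c)
    {S : LightlikeGeometry.ScreenDistribution (E := E) g f}
    (hS : LightlikeGeometry.IsAlgebraicCurvature (S.inducedCurvature₄ u))
    (hu : (∃ ε ≠ 0, (LightlikeGeometry.pseudoSphere (E := E) g f u ε).Nonempty ∧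
        ∀ ξ n, S.IsNormalizingPair u ξ n →
          ∀ x ∈ LightlikeGeometry.pseudoSphere (E := E) g f u ε,
          ∀ y ∈ LightlikeGeometry.pseudoSphere (E := E) g f u ε,
            LinearMap.trace ℝ E (S.pseudoJacobi u n x) =
              LinearMap.trace ℝ E (S.pseudoJacobi u n y)) ∨
      LightlikeGeometry.pseudoSphere (E := E) g f u 1 = ∅ ∧
        LightlikeGeometry.pseudoSphere (E := E) g f u (-1) = ∅) :
    S.IsEinsteinAt u := by
  rcases hu with ⟨ε, hε, ⟨x₀, hx₀⟩, htrace⟩ | ⟨h₁, h₂⟩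
  · obtain ⟨ξ, n, h⟩ := LightlikeGeometry.ScreenDistribution.exists_isNormalizingPair hf S u
    exact LightlikeGeometry.ScreenDistribution.isEinsteinAt_of_constant_trace hf hS hc h hε
      ⟨x₀, hx₀⟩ fun x hx => htrace ξ n h x hx x₀ hx₀
  · exact LightlikeGeometry.isEinsteinAt_of_inducedMetric_eq_zero hf
      (LightlikeGeometry.inducedMetric_eq_zero_of_pseudoSphere_eq_empty h₁ h₂) S

theorem corollary4p4
    {E : Type*} [NormedAddCommGroup E] [NormedSpace ℝ E] [FiniteDimensional ℝ E]
    {F : Type*} [NormedAddCommGroup F] [NormedSpace ℝ F] [FiniteDimensional ℝ F]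
    {M : Type*} [TopologicalSpace M] [ChartedSpace E M] [IsManifold 𝓘(ℝ, E) ∞ M]
    {N : Type*} [TopologicalSpace N] [ChartedSpace F N] [IsManifold 𝓘(ℝ, F) ∞ N]
    (g : LightlikeGeometry.SemiRiemannianMetric F N) (c : ℝ)
    (hc : g.HasConstantSectionalCurvature c)
    (f : M → N) (hf : LightlikeGeometry.IsLightlikeHypersurface (E := E) g f)
    (u : M) (hu : LightlikeGeometry.IsOssermanAt (E := E) g f u)
    (S : LightlikeGeometry.ScreenDistribution (E := E) g f) (hS : S.IsAdmissible) :
    S.IsEinsteinAt u := by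
  refine corollary4p4_general hf (hc (f u)) (hS u) ?_
  rcases hu with ⟨hne, hJ⟩ | ⟨hne, hJ⟩ | hempty
  · exact .inl ⟨1, one_ne_zero, hne, fun ξ n h x hx y hy =>
      LightlikeGeometry.trace_eq_of_charpoly_eq (hJ S hS ξ n h x hx y hy)⟩
  · exact .inl ⟨-1, by norm_num, hne, fun ξ n h x hx y hy =>
      LightlikeGeometry.trace_eq_of_charpoly_eq (hJ S hS ξ n h x hx y hy)⟩
  · exact .inr hempty
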